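/- Let $d\in\mathbb N$, let $\alpha>1/2$ be real, and let $\gamma=(\gamma_1,\gamma_2,\ldots)$ satisfy $0\le\gamma_j\le 1$ for all $j$. For $k\in\mathbb Z^d$ put $r_{\alpha,\gamma}(k)=\prod_{j\le d,\,k_j\neq 0}|k_j|^{\alpha}/\gamma_j\in[0,\infty]$ (empty product $1$; a factor with $\gamma_j=0$ is $\infty$). The weighted Korobov space $H_{\alpha,\gamma}$ consists of the functions $f:[0,1]^d\to\mathbb R$, one-periodic in each variable, that equal the sum of their absolutely convergent Fourier series $f(x)=\sum_{k\in\mathbb Z^d}\hat f(k)e^{2\pi i k\cdot x}$, satisfy $\hat f(k)=0$ whenever $r_{\alpha,\gamma}(k)=\infty$, and have finite norm $\|f\|_{\alpha,\gamma}=\big(\sum_{k}|\hat f(k)|^2r_{\alpha,\gamma}(k)^2\big)^{1/2}$ (with $0\cdot\infty=0$). Let $I(f)=\int_{[0,1]^d}f(x)\,dx$. For a prime $N$ and $z\in\{1,\ldots,N-1\}^d$ let $Q_{N,z}(f)=\frac1N\sum_{n=0}^{N-1}f(\{nz_1/N\},\ldots,\{nz_d/N\})$, where $\{\cdot\}$ is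 the fractional part, be the rank-1 lattice rule, and let $e^{\mathrm{wor}}(N,z)=\sup_{\|f\|_{\alpha,\gamma}\le1}|I(f)-Q_{N,z}(f)|$ be its worst-case error. For integers $r\ge1$ and $M\ge2$ consider the following randomized rule $A^{\mathrm{ran}}_{r,M}$. Draw $N$ uniformly from the set of primes $p$ with $\lceil M/2\rceil<p\le M$; given $N$, draw $z_1,\ldots,z_r$ independently and uniformly from $\{1,\ldots,N-1\}^d$; let $z^*$ be one of $z_1,\ldots,z_r$ with the smallest value of $e^{\mathrm{wor}}(N,z_j)$ (ties broken arbitrarily); use $Q_{N,z^*}$. Its worst-case randomized error is $$e^{\mathrm{ran}}(H_{\alpha,\gamma};A^{\mathrm{ran}}_{r,M})=\sup_{\|f\|_{\alpha,\gamma}\le1}\mathbb E_{N,z_1,\ldots,z_r}\big[|I(f)-Q_{N,z^*}(f)|\big].$$ **Theorem.** Let $\zeta$ be the Riemann zeta function. For all real $\lambda>1/2$ and $0<\delta<\min(\lambda-1/2,1)$ there is a constant $C_{\lambda,\delta}>0$, depending only on $\lambda$ and $\delta$, with the following property. For all $d$, $\alpha$, $\gamma$, $r$, $M$ as above with $\alpha>\lambda$,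 and all $\eta\in(0,1)$ such that $$(1-\eta)M\ \ge\ \inf_{1/2\le\mu<\alpha}\ 2\prod_{j=1}^d\big(1+2\gamma_j^{1/\mu}\zeta(\alpha/\mu)\big),$$ it holds that $$e^{\mathrm{ran}}(H_{\alpha,\gamma};A^{\mathrm{ran}}_{r,M})\ \le\ \frac{r\,C_{\lambda,\delta}}{(1-\eta)^{\lambda-\delta-1/2}M^{\lambda-\delta+1/2}}\prod_{j=1}^d\big(1+2\gamma_j^{1/\lambda}\zeta(\alpha/\lambda)\big)^{\lambda-\delta}+(1-\eta)^r\prod_{j=1}^d\big(1+2\gamma_j^2\zeta(2\alpha)\big)^{1/2}.$$ -/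

import Mathlib

open MeasureTheory
open scoped ENNReal

noncomputable section

namespace KorobovLattice

/-- The integral of `f` over the unit cube `[0,1]^d`. -/
def cubeIntegral {d : ℕ} (f : (Fin d → ℝ) → ℝ) : ℝ :=
  ∫ x in Set.Icc (0 : Fin d → ℝ) 1, f x

/-- The exponential `x ↦ exp (2 π i k · x)`. -/
def expMode {d : ℕ} (k : Fin d → ℤ) (x : Fin d → ℝ) : ℂ :=
  Complex.exp (2 * Real.pi * Complex.I * ((∑ j, (k j : ℝ) * x j : ℝ) : ℂ))

/-- The `k`-th Fourier coefficient of `f`, the integral over `[0,1]^d` of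
`f x * exp (- 2 π i k · x)`. -/
def fourierCoef {d : ℕ} (f : (Fin d → ℝ) → ℝ) (k : Fin d → ℤ) : ℂ :=
  ∫ x in Set.Icc (0 : Fin d → ℝ) 1, (f x : ℂ) * expMode (-k) x

/-- The function `r_{α,γ}(k)`, the product over the `j` with `k_j ≠ 0` of `|k_j|^α / γ_j`, with
values in `[0,∞]`: a factor with `γ_j = 0` is `∞`, and the empty product is `1`.
The weights are numbered from `0`, so that the first `d` of them are `γ 0, …, γ (d-1)`. -/
def decay (α : ℝ) (γ : ℕ → ℝ) {d : ℕ} (k : Fin d → ℤ) : ℝ≥0∞ :=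
  ∏ j with k j ≠ 0, ENNReal.ofReal (|(k j : ℝ)| ^ α) / ENNReal.ofReal (γ j)

/-- The norm of the weighted Korobov space, the square root of the sum over `k` of
`|f̂(k)|² r_{α,γ}(k)²`, with values in `[0,∞]`. The convention `0 * ∞ = 0` of `ℝ≥0∞` is the one
used for frequencies with `r_{α,γ}(k) = ∞`; the norm is `∞` if `f̂(k) ≠ 0` for such a frequency. -/
def korobovNorm (α : ℝ) (γ : ℕ → ℝ) {d : ℕ} (f : (Fin d → ℝ) → ℝ) : ℝ≥0∞ :=
  (∑' k : Fin d → ℤ, (‖fourierCoef f k‖ₑ * decay α γ k) ^ 2) ^ (1 / 2 : ℝ)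

/-- The weighted Korobov space `H_{α,γ}` (for `α > 1/2`) in dimension `d`: the real functions,
one-periodic in each variable, that are the sum of their absolutely convergent Fourier series and
have finite norm (in particular `f̂(k) = 0` whenever `r_{α,γ}(k) = ∞`). -/
def korobovSpace (α : ℝ) (γ : ℕ → ℝ) (d : ℕ) : Set ((Fin d → ℝ) → ℝ) :=
  {f | (∀ (x : Fin d → ℝ) (j : Fin d), f (x + Pi.single j 1) = f x) ∧
    Summable (fun k : Fin d → ℤ => ‖fourierCoef f k‖) ∧
    (∀ x, HasSum (fun k : Fin d → ℤ => fourierCoef f k * expMode k x) (f x : ℂ)) ∧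
    korobovNorm α γ f < ∞}

/-- The closed unit ball of `H_{α,γ}`. -/
def korobovBall (α : ℝ) (γ : ℕ → ℝ) (d : ℕ) : Set ((Fin d → ℝ) → ℝ) :=
  {f ∈ korobovSpace α γ d | korobovNorm α γ f ≤ 1}

/-- The worst-case error in `H_{α,γ}` of a deterministic cubature rule `Q`, in `[0,∞]`. -/
def worstCaseError (α : ℝ) (γ : ℕ → ℝ) {d : ℕ} (Q : ((Fin d → ℝ) → ℝ) → ℝ) : ℝ≥0∞ :=
  ⨆ f ∈ korobovBall α γ d, ENNReal.ofReal |cubeIntegral f - Q f|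

/-- The worst-case randomized error in `H_{α,γ}` of a randomized cubature rule `(Q ω)` on a
probability space `(Ω, μ)`, in `[0,∞]`: the supremum over the unit ball of the expected error. -/
def randomizedError (α : ℝ) (γ : ℕ → ℝ) {d : ℕ} {Ω : Type*} [MeasurableSpace Ω] (μ : Measure Ω)
    (Q : Ω → ((Fin d → ℝ) → ℝ) → ℝ) : ℝ≥0∞ :=
  ⨆ f ∈ korobovBall α γ d, ∫⁻ ω, ENNReal.ofReal |cubeIntegral f - Q ω f| ∂μ

/-- The `n`-th point of the rank-1 lattice point set with `N` points and generating vector `z`. -/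
def latticePoint {d : ℕ} (N : ℕ) (z : Fin d → ℕ) (n : ℕ) : Fin d → ℝ :=
  fun j => Int.fract ((n : ℝ) * (z j : ℝ) / (N : ℝ))

/-- The rank-1 lattice rule with `N` points and generating vector `z`. -/
def latticeRule {d : ℕ} (N : ℕ) (z : Fin d → ℕ) (f : (Fin d → ℝ) → ℝ) : ℝ :=
  (1 / (N : ℝ)) * ∑ n ∈ Finset.range N, f (latticePoint N z n)

/-- The set of the primes `p` with `⌈M/2⌉ < p ≤ M`. -/
def primeSet (M : ℕ) : Finset ℕ :=
  (Finset.Ioc ⌈(M : ℝ) / 2⌉₊ M).filter Nat.Prime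

/-- The set `{1, …, N-1}^d` of generating vectors. -/
def genVectors (d N : ℕ) : Finset (Fin d → ℕ) :=
  Fintype.piFinset fun _ => Finset.Icc 1 (N - 1)

/-- The set of all `r`-tuples of generating vectors. -/
def genTuples (d r N : ℕ) : Finset (Fin r → Fin d → ℕ) :=
  Fintype.piFinset fun _ => genVectors d N

/-- The joint law of the random draws `(N, (z_1, …, z_r))` of the algorithm: `N` is uniform on
`primeSet M` and, given `N`, the vectors `z_1, …, z_r` are independent and uniform on
`{1, …, N-1}^d`, that is, the tuple is uniform on `({1, …, N-1}^d)^r`. -/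
def drawLaw (d r M : ℕ) : Measure (ℕ × (Fin r → Fin d → ℕ)) :=
  ∑ N ∈ primeSet M, ∑ Z ∈ genTuples d r N,
    (((primeSet M).card : ℝ≥0∞)⁻¹ * ((genTuples d r N).card : ℝ≥0∞)⁻¹) • Measure.dirac (N, Z)

/-- `sel` picks, for every possible outcome of the draws, the index of a vector among
`z_1, …, z_r` with the smallest worst-case error; ties are broken in an arbitrary way. -/
def IsArgminSelection (α : ℝ) (γ : ℕ → ℝ) (d r M : ℕ)
    (sel : ℕ × (Fin r → Fin d → ℕ) → Fin r) : Prop :=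
  ∀ N ∈ primeSet M, ∀ Z ∈ genTuples d r N, ∀ i : Fin r,
    worstCaseError α γ (latticeRule N (Z (sel (N, Z)))) ≤ worstCaseError α γ (latticeRule N (Z i))

/-- The randomized lattice rule of the algorithm: the rank-1 lattice rule with `N` points and the
generating vector selected among `z_1, …, z_r`. -/
def algRule {d r : ℕ} (sel : ℕ × (Fin r → Fin d → ℕ) → Fin r)
    (ω : ℕ × (Fin r → Fin d → ℕ)) : ((Fin d → ℝ) → ℝ) → ℝ :=
  latticeRule ω.1 (ω.2 (sel ω))

/-- The Riemann zeta function at a real argument. -/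
def zetaR (s : ℝ) : ℝ := (riemannZeta (s : ℂ)).re

/-- The product over the first `d` weights of `1 + 2 γ_j^{1/l} ζ(α/l)`. -/
def weightProd (α : ℝ) (γ : ℕ → ℝ) (d : ℕ) (l : ℝ) : ℝ :=
  ∏ j : Fin d, (1 + 2 * γ j ^ (1 / l) * zetaR (α / l))

end KorobovLattice

end

open KorobovLattice

/-! Write w(k) = 1/r(k). A lattice rule integrates f with error at most the sum of |f̂(k)| over the
nonzero k in the dual lattice of z, so everything depends on which frequencies are aliased.

Two facts about the worst-case error are combined. Averaging over z and Markov's inequality show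
that, for a threshold T of order (W/((1-η)M))^λ with W the sum of w^(1/λ), at most a fraction 1-η of
the vectors z have error above T (`card_bad_genVectors_le`). All r draws are therefore bad with
probability at most (1-η)^r, and then the trivial bound by the square root of the sum of w² gives
the second term. Conversely, testing the rule on a cosine shows that every nonzero dual frequency
has w(k) at most the worst-case error (`freqWeight_le_worstCaseError`). So outside the bad event the
selected rule aliases only frequencies with w(k) ≤ T.

For these frequencies the randomness of N gains a further factor 1/M. A fixed k ≠ 0 is dual with
probability of order (1 + log|k_j|)/M, for any j with k_j ≠ 0: either N divides k_j, which few
primes do because a Chebyshev bound supplies about M/log M primes, or z_j is determined modulo N by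
the other components (`exists_dualProb_le`). The logarithm is paid for by w^(δ/λ). Cauchy-Schwarz
together with w ≤ T then gives the first term; the factor r comes from replacing the selected vector
by the sum over all r draws. -/

open KorobovLattice

/-! ### Primes in `(n, 2n]` -/

/-- The primes `p` with `n < p ≤ 2 n`. -/
def bertrandPrimes (n : ℕ) : Finset ℕ := (Finset.Ioc n (2 * n)).filter Nat.Prime

theorem bertrandPrimes_card_pos {n : ℕ} (hn : n ≠ 0) : 0 < (bertrandPrimes n).card := by
  obtain ⟨p, hp, h1, h2⟩ := Nat.exists_prime_lt_and_le_two_mul n hn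
  exact Finset.card_pos.2 ⟨p, by simp [bertrandPrimes, hp, h1, h2]⟩

-- Erdős's argument for Bertrand's postulate, keeping the primes above n. Primes in (2n/3, n] do not
-- divide the binomial coefficient. Those up to √(2n) contribute at most 2n each, those from there
-- to 2n/3 occur at most once and are covered by the primorial bound, and each prime in (n, 2n]
-- contributes at most 2n.
open Nat in
theorem centralBinom_le_pow_card_bertrandPrimes (n : ℕ) (n_large : 2 < n) :
    centralBinom n ≤
      (2 * n) ^ sqrt (2 * n) * 4 ^ (2 * n / 3) * (2 * n) ^ (bertrandPrimes n).card := by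
  have n_pos : 0 < n := (Nat.zero_le _).trans_lt n_large
  have n2_pos : 1 ≤ 2 * n := mul_pos (zero_lt_two' ℕ) n_pos
  let f x := x ^ n.centralBinom.factorization x
  let S := {p ∈ Finset.range (2 * n / 3 + 1) | Nat.Prime p}
  have hsub : S ∪ bertrandPrimes n ⊆ Finset.range (2 * n + 1) := by
    intro x hx
    simp only [S, bertrandPrimes, Finset.mem_union, Finset.mem_filter, Finset.mem_range,
      Finset.mem_Ioc] at hx ⊢
    omega
  have hprod : centralBinom n = ∏ p ∈ S ∪ bertrandPrimes n, f p := by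
    refine (Eq.trans ?_ n.prod_pow_factorization_centralBinom).symm
    apply Finset.prod_subset hsub
    intro x hx h2x
    by_cases hp : x.Prime
    · simp only [S, bertrandPrimes, Finset.mem_union, Finset.mem_filter, Finset.mem_range,
        Finset.mem_Ioc, hp, and_true, not_or] at hx h2x
      have h3 : x ≤ n := by omega
      have h4 : 2 * n < 3 * x := by omega
      simp only [f]
      rw [factorization_centralBinom_of_two_mul_self_lt_three_mul n_large h3 h4, Nat.pow_zero]
    · simp only [f]
      rw [factorization_eq_zero_of_not_prime n.centralBinom hp, Nat.pow_zero]
  have hdisj : Disjoint S (bertrandPrimes n) := by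
    rw [Finset.disjoint_left]
    intro x hx hx'
    simp only [S, bertrandPrimes, Finset.mem_filter, Finset.mem_range, Finset.mem_Ioc] at hx hx'
    omega
  have hf : ∀ p, f p ≤ 2 * n := fun p => pow_factorization_choose_le (mul_pos two_pos n_pos)
  rw [hprod, Finset.prod_union hdisj, ← Finset.prod_filter_mul_prod_filter_not S (· ≤ sqrt (2 * n))]
  apply mul_le_mul'
  · apply mul_le_mul'
    · refine (Finset.prod_le_prod' fun p _ => hf p).trans ?_
      have : (Finset.Icc 1 (sqrt (2 * n))).card = sqrt (2 * n) := by
        rw [card_Icc, Nat.add_sub_cancel]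
      rw [Finset.prod_const]
      refine pow_right_mono₀ n2_pos ((Finset.card_le_card fun x hx => ?_).trans this.le)
      obtain ⟨h1, h2⟩ := Finset.mem_filter.1 hx
      exact Finset.mem_Icc.mpr ⟨(Finset.mem_filter.1 h1).2.one_lt.le, h2⟩
    · refine le_trans ?_ (primorial_le_four_pow (2 * n / 3))
      refine (Finset.prod_le_prod' fun p hp => (?_ : f p ≤ p)).trans ?_
      · obtain ⟨h1, h2⟩ := Finset.mem_filter.1 hp
        refine (pow_right_mono₀ (Finset.mem_filter.1 h1).2.one_lt.le ?_).trans (pow_one p).le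
        exact Nat.factorization_choose_le_one (sqrt_lt'.mp <| not_le.1 h2)
      refine Finset.prod_le_prod_of_subset_of_one_le' (Finset.filter_subset _ _) ?_
      exact fun p hp _ => (Finset.mem_filter.1 hp).2.one_lt.le
  · refine (Finset.prod_le_prod' fun p _ => hf p).trans ?_
    rw [Finset.prod_const]

theorem log_lower_bound_card_bertrandPrimes {n : ℕ} (hn : 4 ≤ n) :
    n * (Real.log 4 / 3) ≤
      ((bertrandPrimes n).card + Real.sqrt (2 * n) + 1) * Real.log (2 * n) := by
  have h1 := Nat.four_pow_lt_mul_centralBinom n hn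
  have h2 := centralBinom_le_pow_card_bertrandPrimes n (by omega)
  have h3 : (4 : ℝ) ^ n ≤ n * ((2 * n) ^ Nat.sqrt (2 * n) * 4 ^ (2 * n / 3) *
      (2 * n) ^ (bertrandPrimes n).card) := by
    exact_mod_cast h1.le.trans (Nat.mul_le_mul_left n h2)
  have hn0 : (0 : ℝ) < n := by exact_mod_cast (by omega : 0 < n)
  have h4 := Real.log_le_log (by positivity) h3
  rw [Real.log_mul (by positivity) (by positivity), Real.log_mul (by positivity) (by positivity),
    Real.log_mul (by positivity) (by positivity), Real.log_pow, Real.log_pow, Real.log_pow,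
    Real.log_pow] at h4
  have h5 : ((2 * n / 3 : ℕ) : ℝ) ≤ 2 * n / 3 := by
    exact_mod_cast (Nat.cast_div_le (α := ℝ) (m := 2 * n) (n := 3))
  have h6 : ((Nat.sqrt (2 * n) : ℕ) : ℝ) ≤ Real.sqrt (2 * n) := by
    exact_mod_cast Real.nat_sqrt_le_real_sqrt (a := 2 * n)
  have h7 : Real.log n ≤ Real.log (2 * n) := Real.log_le_log hn0 (by linarith)
  have h8 : 0 ≤ Real.log (2 * n) := Real.log_nonneg (by
    have : (4 : ℝ) ≤ n := by exact_mod_cast hn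
    linarith)
  have h9 : 0 ≤ Real.log 4 := Real.log_nonneg (by norm_num)
  nlinarith [mul_le_mul_of_nonneg_right h5 h9, mul_le_mul_of_nonneg_right h6 h8]

theorem exists_eventually_card_bertrandPrimes :
    ∃ n₀ : ℕ, ∀ n ≥ n₀, n * (Real.log 4 / 6) ≤ (bertrandPrimes n).card * Real.log (2 * n) := by
  have h9 : 0 < Real.log 4 := Real.log_pos (by norm_num)
  have hlo : (fun x : ℝ => (Real.sqrt x + 1) * Real.log x) =o[Filter.atTop] fun x : ℝ => x := by
    have h1 : (fun x : ℝ => Real.sqrt x + 1) =O[Filter.atTop] fun x : ℝ => x ^ (1 / 2 : ℝ) := by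
      refine Asymptotics.IsBigO.of_bound 2 ?_
      filter_upwards [Filter.eventually_ge_atTop 1] with x hx
      have : 1 ≤ Real.sqrt x := Real.one_le_sqrt.2 hx
      rw [← Real.sqrt_eq_rpow, Real.norm_of_nonneg (by positivity),
        Real.norm_of_nonneg (by positivity)]
      linarith
    have h2 := h1.mul_isLittleO (isLittleO_log_rpow_atTop (r := 1 / 2) (by norm_num))
    refine h2.congr' Filter.EventuallyEq.rfl ?_
    filter_upwards [Filter.eventually_gt_atTop 0] with x hx
    rw [← Real.rpow_add hx]; norm_num
  -- At x = 2n this bounds the lower-order term by n log 4 / 6, half of the main term n log 4 / 3.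
  have h1 := hlo.bound (show 0 < Real.log 4 / 12 by positivity)
  have h2 : Filter.Tendsto (fun n : ℕ => 2 * (n : ℝ)) Filter.atTop Filter.atTop :=
    tendsto_natCast_atTop_atTop.const_mul_atTop (by norm_num)
  have h3 := (h2.eventually h1).and (Filter.eventually_ge_atTop 4)
  obtain ⟨n₀, h⟩ := Filter.eventually_atTop.1 h3
  refine ⟨n₀, fun n hn => ?_⟩
  obtain ⟨h4, h5⟩ := h n hn
  have h6 := log_lower_bound_card_bertrandPrimes h5
  have h7 := (Real.le_norm_self _).trans h4
  rw [Real.norm_of_nonneg (by positivity)] at h7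
  nlinarith

theorem exists_card_bertrandPrimes_lower_bound :
    ∃ c : ℝ, 0 < c ∧ ∀ n : ℕ, n ≠ 0 → c * n ≤ (bertrandPrimes n).card * Real.log (2 * n) := by
  obtain ⟨n₀, h⟩ := exists_eventually_card_bertrandPrimes
  have h9 : 0 < Real.log 4 := Real.log_pos (by norm_num)
  have h2 : 0 < Real.log 2 := Real.log_pos (by norm_num)
  refine ⟨min (Real.log 4 / 6) (Real.log 2 / (n₀ + 1)), by positivity, fun n hn => ?_⟩
  rcases le_or_gt n₀ n with hle | hlt
  · refine le_trans ?_ (h n hle)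
    rw [mul_comm]
    gcongr
    exact min_le_left _ _
  -- For the finitely many small n, Bertrand's postulate already supplies one prime.
  · have h1 : (1 : ℝ) ≤ (bertrandPrimes n).card := by exact_mod_cast bertrandPrimes_card_pos hn
    have h3 : (1 : ℝ) ≤ n := by exact_mod_cast Nat.one_le_iff_ne_zero.2 hn
    have h4 : Real.log 2 ≤ Real.log (2 * n) := Real.log_le_log (by norm_num) (by linarith)
    have h5 : (n : ℝ) ≤ n₀ + 1 := by exact_mod_cast (by omega : n ≤ n₀ + 1)
    calc _ ≤ Real.log 2 / (n₀ + 1) * (n₀ + 1) := by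
            gcongr
            exact min_le_right _ _
      _ = 1 * Real.log 2 := by field_simp
      _ ≤ _ := by gcongr

theorem primeSet_eq_bertrandPrimes {M : ℕ} (hM : 2 ≤ M) :
    KorobovLattice.primeSet M = bertrandPrimes ⌈(M : ℝ) / 2⌉₊ := by
  have h1 : ⌈(M : ℝ) / 2⌉₊ = (M + 1) / 2 := by
    rw [Nat.ceil_eq_iff (by omega)]
    constructor
    · have : ((M + 1) / 2 - 1) * 2 < M := by omega
      rw [lt_div_iff₀ (by norm_num)]
      exact_mod_cast this
    · rw [div_le_iff₀ (by norm_num)]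
      exact_mod_cast (by omega : M ≤ (M + 1) / 2 * 2)
  ext p
  simp only [KorobovLattice.primeSet, bertrandPrimes, h1, Finset.mem_filter, Finset.mem_Ioc]
  constructor
  · rintro ⟨⟨h2, h3⟩, hp⟩
    exact ⟨⟨h2, by omega⟩, hp⟩
  · rintro ⟨⟨h2, h3⟩, hp⟩
    refine ⟨⟨h2, ?_⟩, hp⟩
    -- The two ranges differ only for odd M, by the number M + 1, which is even and larger than 2.
    by_contra hlt
    have h4 : p = 2 * ((M + 1) / 2) := by omega
    rcases hp.eq_one_or_self_of_dvd 2 ⟨_, h4⟩ with h | h <;> omega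

/-- The number of primes in `(n, 2n]` that divide a nonzero integer `m` is at most
`log |m| / log (n + 1)`. -/
theorem card_bertrandPrimes_dvd_mul_log_le (n : ℕ) {m : ℤ} (hm : m ≠ 0) :
    (((bertrandPrimes n).filter fun p : ℕ => (p : ℤ) ∣ m).card : ℝ) * Real.log (n + 1) ≤
      Real.log |(m : ℝ)| := by
  set S := (bertrandPrimes n).filter fun p : ℕ => (p : ℤ) ∣ m
  -- Distinct primes dividing m have a product dividing m, and each of them is at least n + 1.
  have h1 : ∏ p ∈ S, p ∣ m.natAbs := by
    apply Finset.prod_primes_dvd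
    · intro p hp
      simp only [S, bertrandPrimes, Finset.mem_filter] at hp
      exact hp.1.2.prime
    · intro p hp
      simp only [S, bertrandPrimes, Finset.mem_filter] at hp
      exact Int.natCast_dvd.1 hp.2
  have h2 : (n + 1) ^ S.card ≤ m.natAbs := by
    refine le_trans ?_ (Nat.le_of_dvd (by omega) h1)
    rw [← Finset.prod_const]
    apply Finset.prod_le_prod' fun p hp => ?_
    simp only [S, bertrandPrimes, Finset.mem_filter, Finset.mem_Ioc] at hp
    omega
  have h3 : ((n : ℝ) + 1) ^ S.card ≤ |(m : ℝ)| := by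
    rw [← Int.cast_abs, Int.abs_eq_natAbs]
    exact_mod_cast h2
  rw [← Real.log_pow]
  exact Real.log_le_log (by positivity) h3

/-- The one-dimensional factor of the reciprocal of `decay`: `1` at `0`, `g / |n|^α` elsewhere. -/
noncomputable def coordWeight (α g : ℝ) (n : ℤ) : ℝ := if n = 0 then 1 else g / |(n : ℝ)| ^ α

/-- The reciprocal `1 / r_{α,γ}(k)` of `decay`. -/
noncomputable def freqWeight (α : ℝ) (γ : ℕ → ℝ) {d : ℕ} (k : Fin d → ℤ) : ℝ≥0∞ :=
  ∏ j : Fin d, ENNReal.ofReal (coordWeight α (γ j) (k j))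

/-! ### Elementary bounds for the reciprocal weights -/

theorem one_le_abs_intCast {n : ℤ} (hn : n ≠ 0) : (1 : ℝ) ≤ |(n : ℝ)| := by
  rw [← Int.cast_abs]
  exact_mod_cast Int.one_le_abs hn

theorem one_le_abs_intCast_rpow {α : ℝ} (hα : 0 ≤ α) {n : ℤ} (hn : n ≠ 0) :
    (1 : ℝ) ≤ |(n : ℝ)| ^ α :=
  Real.one_le_rpow (one_le_abs_intCast hn) hα

theorem coordWeight_nonneg {α g : ℝ} (hg : 0 ≤ g) (n : ℤ) : 0 ≤ coordWeight α g n := by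
  unfold coordWeight
  split_ifs <;> positivity

theorem coordWeight_le_one {α g : ℝ} (hα : 0 ≤ α) (hg : g ≤ 1) (n : ℤ) :
    coordWeight α g n ≤ 1 := by
  unfold coordWeight
  split_ifs with h
  · rfl
  · have := one_le_abs_intCast_rpow hα h
    rw [div_le_one (by linarith)]
    linarith

theorem freqWeight_ne_top {α : ℝ} {γ : ℕ → ℝ} {d : ℕ} (k : Fin d → ℤ) :
    freqWeight α γ k ≠ ∞ :=
  ENNReal.prod_ne_top fun _ _ => ENNReal.ofReal_ne_top

/-- The reciprocal is always finite: a vanishing γ_j turns into the value 0 instead of ∞. This is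
what makes the later power sums convenient. -/
theorem decay_eq_inv_freqWeight {α : ℝ} {γ : ℕ → ℝ} (hα : 0 ≤ α) {d : ℕ}
    (k : Fin d → ℤ) : decay α γ k = (freqWeight α γ k)⁻¹ := by
  unfold decay freqWeight
  rw [ENNReal.prod_inv_distrib, Finset.prod_filter]
  · refine Finset.prod_congr rfl fun j _ => ?_
    by_cases h : k j = 0
    · simp [h, coordWeight]
    · have := one_le_abs_intCast_rpow hα h
      simp only [ne_eq, h, not_false_eq_true, if_true, coordWeight, if_false]
      rw [ENNReal.ofReal_div_of_pos (by linarith), ENNReal.inv_div]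
      · exact Or.inl ENNReal.ofReal_ne_top
      · left
        simpa using by linarith
  · intro i _ j _ _
    exact Or.inr ENNReal.ofReal_ne_top

theorem decay_neg {α : ℝ} {γ : ℕ → ℝ} {d : ℕ} (k : Fin d → ℤ) :
    decay α γ (-k) = decay α γ k := by
  simp [decay]

theorem freqWeight_le_ofReal_coord {α : ℝ} {γ : ℕ → ℝ} (hα : 0 ≤ α) (hγ1 : ∀ j, γ j ≤ 1) {d : ℕ}
    {k : Fin d → ℤ} {j : Fin d} (hj : k j ≠ 0) :
    freqWeight α γ k ≤ ENNReal.ofReal (1 / |(k j : ℝ)| ^ α) := by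
  have h := one_le_abs_intCast_rpow hα hj
  unfold freqWeight
  rw [← Finset.mul_prod_erase _ _ (Finset.mem_univ j)]
  refine (mul_le_of_le_one_right' (Finset.prod_le_one' fun i _ => ?_)).trans ?_
  · simpa using ENNReal.ofReal_le_ofReal (coordWeight_le_one hα (hγ1 i) (k i))
  · apply ENNReal.ofReal_le_ofReal
    simp only [coordWeight, hj, if_false]
    have := hγ1 j
    gcongr

/-- Every nonzero coordinate yields a factor N^(-α). Only one of them is kept, which is enough for
the sum over multiples of N. -/
theorem freqWeight_smul_le {α : ℝ} {γ : ℕ → ℝ} (hα : 0 ≤ α) (hγ : ∀ j, 0 ≤ γ j)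
    {d : ℕ} {k : Fin d → ℤ} (hk : k ≠ 0) {N : ℕ} (hN : N ≠ 0) :
    freqWeight α γ ((N : ℤ) • k) ≤ ENNReal.ofReal (1 / (N : ℝ) ^ α) * freqWeight α γ k := by
  obtain ⟨j, hj⟩ := Function.ne_iff.1 hk
  simp only [Pi.zero_apply] at hj
  have hN1 : (1 : ℝ) ≤ (N : ℝ) ^ α :=
    Real.one_le_rpow (by exact_mod_cast Nat.one_le_iff_ne_zero.2 hN) hα
  have key : ∀ i, k i ≠ 0 → coordWeight α (γ i) (((N : ℤ) • k) i) =
      1 / (N : ℝ) ^ α * coordWeight α (γ i) (k i) := by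
    intro i hi
    simp only [coordWeight, Pi.smul_apply, smul_eq_mul, mul_eq_zero, hi, or_false,
      Nat.cast_eq_zero, hN, if_false]
    push_cast
    rw [abs_mul, Real.mul_rpow (abs_nonneg _) (abs_nonneg _), Nat.abs_cast]
    field_simp
  unfold freqWeight
  rw [← Finset.mul_prod_erase _ _ (Finset.mem_univ j), ← Finset.mul_prod_erase _ _
    (Finset.mem_univ j), ← mul_assoc, key j hj, ENNReal.ofReal_mul (by positivity)]
  gcongr with i _
  by_cases hi : k i = 0
  · simp [coordWeight, hi]
  · rw [key i hi]
    have := coordWeight_nonneg (α := α) (hγ i) (k i)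
    refine mul_le_of_le_one_left this ?_
    rw [div_le_one (by linarith)]
    exact hN1

/-! ### Sums of powers of the weights -/

theorem ENNReal.tsum_pi_prod_eq_prod_tsum {ι : Type*} :
    ∀ {d : ℕ} (g : Fin d → ι → ℝ≥0∞), ∑' k : Fin d → ι, ∏ j, g j (k j) = ∏ j, ∑' n, g j n
  | 0, g => by simp
  | d + 1, g => by
    rw [← (Fin.consEquiv fun _ : Fin (d + 1) => ι).tsum_eq, ENNReal.tsum_prod', Fin.prod_univ_succ,
      ← ENNReal.tsum_pi_prod_eq_prod_tsum (fun j => g j.succ), ← ENNReal.tsum_mul_right]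
    refine tsum_congr fun n => ?_
    rw [← ENNReal.tsum_mul_left]
    refine tsum_congr fun k => ?_
    simp [Fin.consEquiv, Fin.prod_univ_succ]

theorem hasSum_zetaR {s : ℝ} (hs : 1 < s) :
    HasSum (fun n : ℕ => 1 / ((n : ℝ) + 1) ^ s) (zetaR s) := by
  have h1 : Summable fun n : ℕ => 1 / ((n : ℝ) + 1) ^ s := by
    have := (summable_nat_add_iff 1).2 (Real.summable_one_div_nat_rpow.2 hs)
    exact_mod_cast this
  have h2 : (riemannZeta (s : ℂ)) = ((∑' n : ℕ, 1 / ((n : ℝ) + 1) ^ s : ℝ) : ℂ) := by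
    rw [zeta_eq_tsum_one_div_nat_add_one_cpow (by simpa using hs), Complex.ofReal_tsum]
    refine tsum_congr fun n => ?_
    push_cast
    rw [Complex.ofReal_cpow (by positivity)]
    push_cast
    rfl
  have h3 : zetaR s = ∑' n : ℕ, 1 / ((n : ℝ) + 1) ^ s := by
    rw [zetaR, h2, Complex.ofReal_re]
  rw [h3]
  exact h1.hasSum

theorem zetaR_nonneg {s : ℝ} (hs : 1 < s) : 0 ≤ zetaR s :=
  (hasSum_zetaR hs).nonneg fun n => by positivity

theorem tsum_coordWeight_rpow {α g p : ℝ} (hg : 0 ≤ g) (hp : 0 < p) (hαp : 1 < α * p) :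
    ∑' n : ℤ, ENNReal.ofReal (coordWeight α g n) ^ p =
      ENNReal.ofReal (1 + 2 * g ^ p * zetaR (α * p)) := by
  have h1 : HasSum (fun n : ℕ => g ^ p * (1 / ((n : ℝ) + 1) ^ (α * p))) (g ^ p * zetaR (α * p)) :=
    (hasSum_zetaR hαp).mul_left _
  have h2 : ∀ n : ℤ, n ≠ 0 → coordWeight α g n ^ p = g ^ p * (1 / |(n : ℝ)| ^ (α * p)) := by
    intro n hn
    simp only [coordWeight, hn, if_false]
    rw [Real.div_rpow hg (by positivity), ← Real.rpow_mul (abs_nonneg _)]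
    ring
  have hpos : ∀ n : ℕ, |(n : ℝ) + 1| = n + 1 := fun n => abs_of_nonneg (by positivity)
  have h3 : HasSum (fun n : ℤ => coordWeight α g n ^ p)
      (g ^ p * zetaR (α * p) + coordWeight α g 0 ^ p + g ^ p * zetaR (α * p)) := by
    apply HasSum.of_add_one_of_neg_add_one
    · convert h1 using 2 with n
      rw [h2 _ (by omega)]
      push_cast
      rw [hpos]
    · convert h1 using 2 with n
      rw [h2 _ (by omega)]
      push_cast
      rw [abs_neg, hpos]
  simp only [ENNReal.ofReal_rpow_of_nonneg (coordWeight_nonneg hg _) hp.le]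
  rw [← ENNReal.ofReal_tsum_of_nonneg (fun n => Real.rpow_nonneg (coordWeight_nonneg hg n) _)
    h3.summable, h3.tsum_eq]
  congr 1
  simp [coordWeight]
  ring

theorem tsum_freqWeight_rpow {α p : ℝ} {γ : ℕ → ℝ} (hγ : ∀ j, 0 ≤ γ j) (hp : 0 < p)
    (hαp : 1 < α * p) (d : ℕ) :
    ∑' k : Fin d → ℤ, freqWeight α γ k ^ p =
      ENNReal.ofReal (∏ j : Fin d, (1 + 2 * γ j ^ p * zetaR (α * p))) := by
  have h0 := zetaR_nonneg hαp
  rw [ENNReal.ofReal_prod_of_nonneg]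
  · simp only [freqWeight, ← ENNReal.prod_rpow_of_nonneg hp.le]
    rw [ENNReal.tsum_pi_prod_eq_prod_tsum fun (j : Fin d) n =>
      ENNReal.ofReal (coordWeight α (γ j) n) ^ p]
    exact Finset.prod_congr rfl fun j _ => tsum_coordWeight_rpow (hγ j) hp hαp
  · intro j _
    have := hγ j
    positivity

/-! ### Inequalities for sums in `[0,∞]` -/

theorem ENNReal.tsum_mul_le_sqrt_mul_sqrt {ι : Type*} (f g : ι → ℝ≥0∞) :
    ∑' i, f i * g i ≤ (∑' i, f i ^ 2) ^ (1 / 2 : ℝ) * (∑' i, g i ^ 2) ^ (1 / 2 : ℝ) := by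
  let _ : MeasurableSpace ι := ⊤
  have := ENNReal.lintegral_mul_le_Lp_mul_Lq (Measure.count : Measure ι)
    (p := 2) (q := 2) (by rw [Real.holderConjugate_iff]; norm_num)
    (f := f) (g := g) measurable_from_top.aemeasurable measurable_from_top.aemeasurable
  simpa [lintegral_count] using this

/-- In f_i^p = f_i^(p-1) f_i the first factor is at most the (p-1)-th power of the whole sum. -/
theorem ENNReal.tsum_rpow_le_rpow_tsum {ι : Type*} (f : ι → ℝ≥0∞) {p : ℝ} (hp : 1 ≤ p) :
    ∑' i, f i ^ p ≤ (∑' i, f i) ^ p := by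
  have h : ∀ x : ℝ≥0∞, x ^ p = x ^ (p - 1) * x := fun x => by
    conv_lhs => rw [show p = (p - 1) + 1 by ring,
      ENNReal.rpow_add_of_nonneg _ _ (by linarith) zero_le_one, ENNReal.rpow_one]
  rw [h (∑' i, f i), ← ENNReal.tsum_mul_left]
  refine ENNReal.tsum_le_tsum fun i => ?_
  rw [h]
  gcongr
  exact ENNReal.le_tsum i

/-- `k` lies in the dual lattice of the rank-1 lattice generated by `z` modulo `N`. -/
def IsDualFreq {d : ℕ} (N : ℕ) (z : Fin d → ℕ) (k : Fin d → ℤ) : Prop :=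
  (N : ℤ) ∣ ∑ j, k j * (z j : ℤ)

theorem IsDualFreq.neg {d N : ℕ} {z : Fin d → ℕ} {k : Fin d → ℤ} (h : IsDualFreq N z k) :
    IsDualFreq N z (-k) := by
  simpa [IsDualFreq] using h

/-! ### Exponential modes -/

theorem expMode_zero {d : ℕ} (x : Fin d → ℝ) : expMode 0 x = 1 := by
  simp [expMode]

theorem expMode_add {d : ℕ} (k l : Fin d → ℤ) (x : Fin d → ℝ) :
    expMode (k + l) x = expMode k x * expMode l x := by
  simp only [expMode, ← Complex.exp_add]
  congr 1
  simp only [Pi.add_apply, Int.cast_add, add_mul, Finset.sum_add_distrib]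
  push_cast
  ring

theorem expMode_eq_prod {d : ℕ} (k : Fin d → ℤ) (x : Fin d → ℝ) :
    expMode k x = ∏ j, Complex.exp (2 * Real.pi * Complex.I * (k j : ℂ) * (x j : ℂ)) := by
  simp only [expMode, ← Complex.exp_sum]
  congr 1
  push_cast
  rw [Finset.mul_sum]
  exact Finset.sum_congr rfl fun j _ => by ring

theorem continuous_expMode {d : ℕ} (k : Fin d → ℤ) : Continuous (expMode k) := by
  unfold expMode
  fun_prop

theorem expMode_add_single {d : ℕ} (k : Fin d → ℤ) (x : Fin d → ℝ) (j : Fin d) :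
    expMode k (x + Pi.single j 1) = expMode k x := by
  simp only [expMode]
  rw [Complex.exp_eq_exp_iff_exists_int]
  refine ⟨k j, ?_⟩
  have : ∑ i, (k i : ℝ) * (x + Pi.single j 1 : Fin d → ℝ) i = (∑ i, (k i : ℝ) * x i) + k j := by
    simp [mul_add, Finset.sum_add_distrib, Pi.single_apply]
  rw [this]
  push_cast
  ring

theorem expMode_latticePoint {d : ℕ} (N : ℕ) (z : Fin d → ℕ) (k : Fin d → ℤ) (n : ℕ) :
    expMode k (latticePoint N z n) =
      Complex.exp (2 * Real.pi * Complex.I * ((∑ j, k j * (z j : ℤ) : ℤ) : ℂ) / N) ^ n := by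
  rw [← Complex.exp_nat_mul, expMode, Complex.exp_eq_exp_iff_exists_int]
  -- Passing to fractional parts changes k · x by an integer, the combination of the floors.
  refine ⟨-∑ j, k j * ⌊(n : ℝ) * (z j : ℝ) / (N : ℝ)⌋, ?_⟩
  have h : ∑ j, (k j : ℝ) * latticePoint N z n j = (n : ℝ) * (∑ j, (k j : ℝ) * (z j : ℝ)) / N -
      ∑ j, (k j : ℝ) * ⌊(n : ℝ) * (z j : ℝ) / (N : ℝ)⌋ := by
    rw [Finset.mul_sum, Finset.sum_div, ← Finset.sum_sub_distrib]
    refine Finset.sum_congr rfl fun j _ => ?_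
    rw [latticePoint, ← Int.self_sub_floor]
    ring
  rw [h]
  push_cast
  ring

theorem sum_expMode_latticePoint {d : ℕ} {N : ℕ} (hN : N ≠ 0) (z : Fin d → ℕ) (k : Fin d → ℤ)
    [Decidable (IsDualFreq N z k)] :
    ∑ n ∈ Finset.range N, expMode k (latticePoint N z n) =
      if IsDualFreq N z k then (N : ℂ) else 0 := by
  simp only [expMode_latticePoint]
  have hN' : (N : ℂ) ≠ 0 := by exact_mod_cast hN
  set m : ℤ := ∑ j, k j * (z j : ℤ) with hm
  have h1 : Complex.exp (2 * Real.pi * Complex.I * (m : ℂ) / N) = 1 ↔ IsDualFreq N z k := by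
    rw [Complex.exp_eq_one_iff, IsDualFreq, ← hm]
    constructor
    · rintro ⟨n, hn⟩
      refine ⟨n, ?_⟩
      have h2 : (2 * Real.pi * Complex.I : ℂ) ≠ 0 := Complex.two_pi_I_ne_zero
      rw [div_eq_iff hN'] at hn
      have h3 : (2 * Real.pi * Complex.I : ℂ) * m = (2 * Real.pi * Complex.I) * (N * n) := by
        rw [hn]; ring
      have h4 := mul_left_cancel₀ h2 h3
      exact_mod_cast h4
    · rintro ⟨n, hn⟩
      refine ⟨n, ?_⟩
      rw [hn]
      push_cast
      field_simp
  split_ifs with h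
  · rw [h1.2 h]
    simp
  · rw [geom_sum_eq (fun h' => h (h1.1 h')), ← Complex.exp_nat_mul]
    have : Complex.exp (N * (2 * Real.pi * Complex.I * m / N)) = 1 := by
      rw [Complex.exp_eq_one_iff]
      refine ⟨m, ?_⟩
      field_simp
    rw [this]
    simp

theorem integral_exp_two_pi_int (m : ℤ) :
    ∫ x in Set.Icc (0 : ℝ) 1, Complex.exp (2 * Real.pi * Complex.I * (m : ℂ) * (x : ℂ)) =
      if m = 0 then 1 else 0 := by
  rw [integral_Icc_eq_integral_Ioc, ← intervalIntegral.integral_of_le zero_le_one]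
  split_ifs with h
  · simp [h]
  · have hc : 2 * Real.pi * Complex.I * (m : ℂ) ≠ 0 :=
      mul_ne_zero Complex.two_pi_I_ne_zero (by exact_mod_cast h)
    rw [integral_exp_mul_complex hc]
    have : Complex.exp (2 * Real.pi * Complex.I * (m : ℂ)) = 1 := by
      rw [Complex.exp_eq_one_iff]
      exact ⟨m, by ring⟩
    simp [this]

theorem integral_expMode {d : ℕ} (k : Fin d → ℤ) :
    ∫ x in Set.Icc (0 : Fin d → ℝ) 1, expMode k x = if k = 0 then 1 else 0 := by
  have hvol : (volume : Measure (Fin d → ℝ)).restrict (Set.Icc 0 1) =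
      Measure.pi fun _ => (volume : Measure ℝ).restrict (Set.Icc 0 1) := by
    rw [← Set.pi_univ_Icc, volume_pi, Measure.restrict_pi_pi]
    rfl
  rw [hvol]
  simp only [expMode_eq_prod]
  rw [integral_fintype_prod_eq_prod (𝕜 := ℂ)
    (fun (j : Fin d) (t : ℝ) => Complex.exp (2 * Real.pi * Complex.I * (k j : ℂ) * (t : ℂ)))]
  simp only [integral_exp_two_pi_int]
  split_ifs with h
  · simp [h]
  · obtain ⟨j, hj⟩ := Function.ne_iff.1 h
    exact Finset.prod_eq_zero (Finset.mem_univ j) (by simpa using hj)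

/-! ### The error of a lattice rule -/

theorem fourierCoef_zero {d : ℕ} (f : (Fin d → ℝ) → ℝ) :
    fourierCoef f 0 = (cubeIntegral f : ℂ) := by
  simp only [fourierCoef, cubeIntegral, neg_zero, expMode_zero, mul_one]
  exact integral_ofReal

open Classical in
theorem hasSum_latticeRule {α : ℝ} {γ : ℕ → ℝ} {d : ℕ} {f : (Fin d → ℝ) → ℝ}
    (hf : f ∈ korobovSpace α γ d) {N : ℕ} (hN : N ≠ 0) (z : Fin d → ℕ) :
    HasSum (fun k => if IsDualFreq N z k then fourierCoef f k else 0)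
      ((latticeRule N z f : ℝ) : ℂ) := by
  have h1 := (hasSum_sum (s := Finset.range N) fun n _ => hf.2.2.1 (latticePoint N z n)).mul_left
    (1 / (N : ℂ))
  have hN' : (N : ℂ) ≠ 0 := by exact_mod_cast hN
  have h2 : (fun k => if IsDualFreq N z k then fourierCoef f k else 0) = fun k =>
      1 / (N : ℂ) * ∑ n ∈ Finset.range N, fourierCoef f k * expMode k (latticePoint N z n) := by
    ext k
    rw [← Finset.mul_sum, sum_expMode_latticePoint hN]
    split_ifs
    · field_simp
    · simp
  rw [h2]
  simpa [latticeRule] using h1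

open Classical in
theorem ofReal_abs_error_le {α : ℝ} {γ : ℕ → ℝ} {d : ℕ} {f : (Fin d → ℝ) → ℝ}
    (hf : f ∈ korobovSpace α γ d) {N : ℕ} (hN : N ≠ 0) (z : Fin d → ℕ) :
    ENNReal.ofReal |cubeIntegral f - latticeRule N z f| ≤
      ∑' k, if k ≠ 0 ∧ IsDualFreq N z k then ‖fourierCoef f k‖ₑ else 0 := by
  have h1 := (hasSum_latticeRule hf hN z).sub (hasSum_ite_eq 0 ((cubeIntegral f : ℝ) : ℂ))
  have h2 : ENNReal.ofReal |cubeIntegral f - latticeRule N z f| =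
      ‖((latticeRule N z f : ℝ) : ℂ) - ((cubeIntegral f : ℝ) : ℂ)‖ₑ := by
    rw [← Complex.ofReal_sub, ← ofReal_norm, Complex.norm_real, Real.norm_eq_abs,
      abs_sub_comm]
  rw [h2, ← h1.tsum_eq]
  refine enorm_tsum_le_tsum_enorm.trans (ENNReal.tsum_le_tsum fun k => ?_)
  by_cases hk : k = 0
  -- Frequency 0 is always dual, and its coefficient is the integral, so it cancels.
  · subst hk
    simp [IsDualFreq, fourierCoef_zero]
  · by_cases hd : IsDualFreq N z k <;> simp [hk, hd]

/-- Cauchy-Schwarz after inserting r(k) w(k) = 1. Where w(k) = 0 this identity fails, but there the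
finite norm forces f̂(k) = 0. -/
theorem tsum_fourierCoef_mul_le {α : ℝ} {γ : ℕ → ℝ} (hα : 0 ≤ α) {d : ℕ}
    {f : (Fin d → ℝ) → ℝ} (hf : f ∈ korobovBall α γ d) (u : (Fin d → ℤ) → ℝ≥0∞) :
    ∑' k, ‖fourierCoef f k‖ₑ * u k ≤ (∑' k, (freqWeight α γ k * u k) ^ 2) ^ (1 / 2 : ℝ) := by
  have h1 : ∀ k, ‖fourierCoef f k‖ₑ * u k =
      (‖fourierCoef f k‖ₑ * decay α γ k) * (freqWeight α γ k * u k) := by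
    intro k
    by_cases hs : freqWeight α γ k = 0
    · have h0 : fourierCoef f k = 0 := by
        by_contra hne
        have h2 : (‖fourierCoef f k‖ₑ * decay α γ k) ^ 2 = ∞ := by
          rw [decay_eq_inv_freqWeight hα, hs, ENNReal.inv_zero, ENNReal.mul_top (by simpa using hne)]
          simp
        have h3 : ∑' k : Fin d → ℤ, (‖fourierCoef f k‖ₑ * decay α γ k) ^ 2 = ∞ :=
          top_unique (h2 ▸ ENNReal.le_tsum k)
        have h4 := hf.2
        rw [korobovNorm, h3, ENNReal.top_rpow_of_pos (by norm_num)] at h4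
        simp at h4
      simp [h0]
    · rw [decay_eq_inv_freqWeight hα, mul_assoc, ← mul_assoc _⁻¹,
        ENNReal.inv_mul_cancel hs (freqWeight_ne_top k), one_mul]
  simp only [h1]
  refine (ENNReal.tsum_mul_le_sqrt_mul_sqrt _ _).trans ?_
  exact mul_le_of_le_one_left' hf.2

open Classical in
theorem worstCaseError_latticeRule_le {α : ℝ} {γ : ℕ → ℝ} (hα : 0 ≤ α) {d : ℕ} {N : ℕ}
    (hN : N ≠ 0) (z : Fin d → ℕ) :
    worstCaseError α γ (latticeRule N z) ≤
      (∑' k, if k ≠ 0 ∧ IsDualFreq N z k then freqWeight α γ k ^ 2 else 0) ^ (1 / 2 : ℝ) := by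
  refine iSup₂_le fun f hf => (ofReal_abs_error_le hf.1 hN z).trans ?_
  have := tsum_fourierCoef_mul_le hα hf fun k => if k ≠ 0 ∧ IsDualFreq N z k then 1 else 0
  simpa only [mul_ite, mul_one, mul_zero, ite_pow, ne_eq, OfNat.ofNat_ne_zero, not_false_eq_true,
    zero_pow] using this

-- Jensen's inequality for sums with exponent 2λ ≥ 1 replaces w² by w^(1/λ), whose sum is the one
-- that is averaged over z.
open Classical in
theorem worstCaseError_latticeRule_le_rpow {α : ℝ} {γ : ℕ → ℝ} (hα : 0 ≤ α) {d : ℕ} {N : ℕ}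
    (hN : N ≠ 0) (z : Fin d → ℕ) {lam : ℝ} (hlam : 1 / 2 ≤ lam) :
    worstCaseError α γ (latticeRule N z) ≤
      (∑' k, if k ≠ 0 ∧ IsDualFreq N z k then freqWeight α γ k ^ (1 / lam) else 0) ^ lam := by
  refine (worstCaseError_latticeRule_le hα hN z).trans ?_
  have h := ENNReal.tsum_rpow_le_rpow_tsum (p := 2 * lam)
    (fun k => if k ≠ 0 ∧ IsDualFreq N z k then freqWeight α γ k ^ (1 / lam) else 0) (by linarith)
  have hl : 0 < lam := by linarith
  have h2 : ∀ k : Fin d → ℤ,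
      (if k ≠ 0 ∧ IsDualFreq N z k then freqWeight α γ k ^ 2 else 0) =
      (if k ≠ 0 ∧ IsDualFreq N z k then freqWeight α γ k ^ (1 / lam) else 0) ^ (2 * lam) := by
    intro k
    split_ifs
    · rw [← ENNReal.rpow_mul, ← ENNReal.rpow_natCast]
      congr 1
      push_cast
      field_simp
    · rw [ENNReal.zero_rpow_of_pos (by linarith)]
  simp only [h2]
  refine (ENNReal.rpow_le_rpow h (by norm_num)).trans_eq ?_
  rw [← ENNReal.rpow_mul]
  congr 1
  ring

/-! ### A lower bound for the worst-case error -/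

/-- The cosine with frequency `k`, scaled to have norm at most `1`. -/
noncomputable def cosMode (α : ℝ) (γ : ℕ → ℝ) {d : ℕ} (k : Fin d → ℤ) (x : Fin d → ℝ) : ℝ :=
  (freqWeight α γ k).toReal * (expMode k x).re

theorem expMode_neg {d : ℕ} (k : Fin d → ℤ) (x : Fin d → ℝ) :
    expMode (-k) x = (starRingEnd ℂ) (expMode k x) := by
  simp only [expMode, ← Complex.exp_conj]
  congr 1
  simp [Complex.conj_ofReal, Complex.conj_ofNat]

theorem ofReal_cosMode {α : ℝ} {γ : ℕ → ℝ} {d : ℕ} (k : Fin d → ℤ) (x : Fin d → ℝ) :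
    ((cosMode α γ k x : ℝ) : ℂ) =
      ((freqWeight α γ k).toReal / 2 : ℝ) * (expMode k x + expMode (-k) x) := by
  rw [expMode_neg, Complex.add_conj, cosMode]
  push_cast
  ring

theorem fourierCoef_cosMode {α : ℝ} {γ : ℕ → ℝ} {d : ℕ} (k m : Fin d → ℤ) :
    fourierCoef (cosMode α γ k) m = ((freqWeight α γ k).toReal / 2 : ℝ) *
      ((if m = k then 1 else 0) + (if m = -k then 1 else 0)) := by
  simp only [fourierCoef, ofReal_cosMode, mul_assoc, add_mul, ← expMode_add]
  have hi : ∀ l : Fin d → ℤ, IntegrableOn (expMode l) (Set.Icc (0 : Fin d → ℝ) 1) := fun l =>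
    (continuous_expMode l).continuousOn.integrableOn_compact isCompact_Icc
  rw [integral_const_mul, integral_add (hi _) (hi _), integral_expMode, integral_expMode]
  have h1 : k + -m = 0 ↔ m = k := by rw [add_neg_eq_zero, eq_comm]
  have h2 : -k + -m = 0 ↔ m = -k := by rw [add_neg_eq_zero, eq_comm]
  simp only [h1, h2]

theorem cosMode_mem_korobovBall {α : ℝ} {γ : ℕ → ℝ} (hα : 0 ≤ α) {d : ℕ} {k : Fin d → ℤ}
    (hs : freqWeight α γ k ≠ 0) : cosMode α γ k ∈ korobovBall α γ d := by
  have hnorm : korobovNorm α γ (cosMode α γ k) ≤ 1 := by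
    have hm : ∀ m : Fin d → ℤ, (‖fourierCoef (cosMode α γ k) m‖ₑ * decay α γ m) ^ 2 ≤
        (if m = k then 1 / 2 else 0) + (if m = -k then 1 / 2 else 0) := by
      intro m
      -- This form also covers k = -k, where the two halves add up to 1. Since y ≤ 1, y² ≤ y, and y
      -- sums to 1 over m.
      set y : ℝ≥0∞ := (if m = k then 1 / 2 else 0) + (if m = -k then 1 / 2 else 0) with hy
      have hy1 : y ≤ 1 := by
        rw [hy]
        split_ifs <;> simp [ENNReal.inv_two_add_inv_two]
      have h1 : ‖fourierCoef (cosMode α γ k) m‖ₑ * decay α γ m ≤ y := by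
        have h2 : ‖(((freqWeight α γ k).toReal / 2 : ℝ) : ℂ)‖ₑ = freqWeight α γ k / 2 := by
          rw [← ofReal_norm, Complex.norm_real, Real.norm_of_nonneg (by positivity),
            ENNReal.ofReal_div_of_pos (by norm_num), ENNReal.ofReal_toReal (freqWeight_ne_top k)]
          simp
        have h3 : ‖((if m = k then 1 else 0) + (if m = -k then 1 else 0) : ℂ)‖ₑ ≤
            (if m = k then 1 else 0) + (if m = -k then 1 else 0) := by
          refine (enorm_add_le _ _).trans (add_le_add ?_ ?_) <;> split_ifs <;> simp
        have h4 : (m = k ∨ m = -k) → decay α γ m = (freqWeight α γ k)⁻¹ := by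
          rintro (h | h) <;> rw [h]
          · exact decay_eq_inv_freqWeight hα k
          · rw [decay_neg, decay_eq_inv_freqWeight hα]
        rw [fourierCoef_cosMode, enorm_mul, h2]
        by_cases h : m = k ∨ m = -k
        · rw [h4 h, mul_right_comm, div_eq_mul_inv, mul_right_comm (freqWeight α γ k),
            ENNReal.mul_inv_cancel hs (freqWeight_ne_top k), one_mul]
          refine (mul_le_mul_right h3 _).trans_eq ?_
          rw [hy, mul_add]
          simp
        · push Not at h
          simp [h.1, h.2]
      calc _ ≤ y ^ 2 := by gcongr
        _ = y * y := sq y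
        _ ≤ y := mul_le_of_le_one_left' hy1
    have h5 : ∑' m : Fin d → ℤ, (‖fourierCoef (cosMode α γ k) m‖ₑ * decay α γ m) ^ 2 ≤ 1 := by
      refine (ENNReal.tsum_le_tsum hm).trans_eq ?_
      rw [ENNReal.tsum_add, tsum_ite_eq, tsum_ite_eq]
      simp [ENNReal.inv_two_add_inv_two]
    exact ENNReal.rpow_le_one h5 (by norm_num)
  refine ⟨⟨fun x j => ?_, ?_, fun x => ?_, hnorm.trans_lt ENNReal.one_lt_top⟩, hnorm⟩
  · simp [cosMode, expMode_add_single]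
  · refine summable_of_ne_finset_zero (s := {k, -k}) fun m hm => ?_
    simp only [Finset.mem_insert, Finset.mem_singleton, not_or] at hm
    simp [fourierCoef_cosMode, hm.1, hm.2]
  · rw [ofReal_cosMode]
    have h1 := ((hasSum_ite_eq k (expMode k x)).add
      (hasSum_ite_eq (-k) (expMode (-k) x))).mul_left (((freqWeight α γ k).toReal / 2 : ℝ) : ℂ)
    refine h1.congr_fun fun m => ?_
    rw [fourierCoef_cosMode, mul_assoc, add_mul]
    congr 2 <;> split_ifs with h <;> simp [h]

/-- The scaled cosine of frequency k has integral 0, but equals its maximum w(k) at every lattice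
point when k is dual. -/
theorem freqWeight_le_worstCaseError {α : ℝ} {γ : ℕ → ℝ} (hα : 0 ≤ α) {d : ℕ} {N : ℕ}
    (hN : N ≠ 0) (z : Fin d → ℕ) {k : Fin d → ℤ} (hk : k ≠ 0) (hd : IsDualFreq N z k) :
    freqWeight α γ k ≤ worstCaseError α γ (latticeRule N z) := by
  classical
  by_cases hs : freqWeight α γ k = 0
  · simp [hs]
  have hf := cosMode_mem_korobovBall hα hs
  refine le_trans ?_ (le_iSup₂ (cosMode α γ k) hf)
  have h1 : cubeIntegral (cosMode α γ k) = 0 := by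
    have := fourierCoef_zero (cosMode α γ k)
    rw [fourierCoef_cosMode, if_neg hk.symm, if_neg (by simpa [eq_comm] using hk)] at this
    simpa using this.symm
  have h2 : latticeRule N z (cosMode α γ k) = (freqWeight α γ k).toReal := by
    have h3 : ((∑ n ∈ Finset.range N, cosMode α γ k (latticePoint N z n) : ℝ) : ℂ) =
        ((freqWeight α γ k).toReal * N : ℝ) := by
      push_cast
      simp only [ofReal_cosMode]
      rw [← Finset.mul_sum, Finset.sum_add_distrib, sum_expMode_latticePoint hN,
        sum_expMode_latticePoint hN, if_pos hd, if_pos hd.neg]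
      push_cast
      ring
    have h4 := Complex.ofReal_injective h3
    have hN' : (N : ℝ) ≠ 0 := by exact_mod_cast hN
    rw [latticeRule, h4]
    field_simp
  rw [h1, h2, zero_sub, abs_neg, abs_of_nonneg ENNReal.toReal_nonneg,
    ENNReal.ofReal_toReal (freqWeight_ne_top k)]

/-! ### Counting generating vectors with a given dual frequency -/

theorem card_genVectors (d N : ℕ) : (genVectors d N).card = (N - 1) ^ d := by
  simp [genVectors]

theorem card_genTuples (d r N : ℕ) : (genTuples d r N).card = (genVectors d N).card ^ r := by
  simp [genTuples]

theorem card_genVectors_ne_zero (d : ℕ) {N : ℕ} (hN : 2 ≤ N) : (genVectors d N).card ≠ 0 := by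
  rw [card_genVectors]
  exact pow_ne_zero _ (by omega)

-- If N does not divide k_j, the other components determine z_j modulo N, hence in {1, …, N-1}.
-- Overwriting z_j by a free value t therefore loses no information.
open Classical in
theorem card_dual_mul_le {d N : ℕ} (hN : N.Prime) {k : Fin d → ℤ} {j : Fin d}
    (hj : ¬ (N : ℤ) ∣ k j) :
    ((genVectors d N).filter fun z => IsDualFreq N z k).card * (N - 1) ≤
      (genVectors d N).card := by
  have h1 : (Finset.Icc 1 (N - 1)).card = N - 1 := by simp
  conv_lhs => rw [← h1, ← Finset.card_product]
  refine Finset.card_le_card_of_injOn (fun q => Function.update q.1 j q.2) ?_ ?_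
  · rintro ⟨z, t⟩ h
    simp only [Finset.coe_product, Set.mem_prod, Finset.mem_coe, Finset.mem_filter, genVectors,
      Fintype.mem_piFinset] at h ⊢
    intro i
    by_cases hi : i = j
    · subst hi
      simpa using h.2
    · simpa [hi] using h.1.1 i
  · rintro ⟨z, t⟩ h ⟨z', t'⟩ h' heq
    simp only [Finset.coe_product, Set.mem_prod, Finset.mem_coe, Finset.mem_filter, genVectors,
      Fintype.mem_piFinset] at h h'
    simp only at heq
    have ht : t = t' := by simpa using congrFun heq j
    have hz : ∀ i, i ≠ j → z i = z' i := fun i hi => by simpa [hi] using congrFun heq i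
    have hzj : z j = z' j := by
      have hdvd : (N : ℤ) ∣ k j * ((z j : ℤ) - z' j) := by
        have h2 := dvd_sub h.1.2 h'.1.2
        rw [← Finset.sum_sub_distrib, Finset.sum_eq_single j] at h2
        · rwa [mul_sub]
        · intro i _ hi
          simp [hz i hi]
        · simp
      rcases (Nat.prime_iff_prime_int.1 hN).dvd_or_dvd hdvd with h2 | h2
      · exact absurd h2 hj
      · have hb := h.1.1 j
        have hb' := h'.1.1 j
        rw [Finset.mem_Icc] at hb hb'
        have h3 := Int.eq_zero_of_abs_lt_dvd h2 (by rw [abs_lt]; omega)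
        omega
    refine Prod.ext (funext fun i => ?_) ht
    by_cases hi : i = j
    · rw [hi]; exact hzj
    · exact hz i hi

open Classical in
theorem dual_fraction_le {d N : ℕ} (hN : N.Prime) (k : Fin d → ℤ) :
    ((genVectors d N).card : ℝ≥0∞)⁻¹ *
        ((genVectors d N).filter fun z => IsDualFreq N z k).card ≤
      (if ∀ j, (N : ℤ) ∣ k j then 1 else 0) + ((N - 1 : ℕ) : ℝ≥0∞)⁻¹ := by
  have h0 := card_genVectors_ne_zero d hN.two_le
  have h0' : ((genVectors d N).card : ℝ≥0∞) ≠ 0 := by exact_mod_cast h0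
  have hN1 : ((N - 1 : ℕ) : ℝ≥0∞) ≠ 0 := by
    have := hN.two_le
    exact_mod_cast (by omega : N - 1 ≠ 0)
  split_ifs with h
  · refine le_trans ?_ le_self_add
    rw [mul_comm, ← div_eq_mul_inv]
    refine ENNReal.div_le_of_le_mul ?_
    rw [one_mul]
    exact_mod_cast Finset.card_filter_le _ _
  · push Not at h
    obtain ⟨j, hj⟩ := h
    rw [zero_add, mul_comm, ← div_eq_mul_inv]
    refine ENNReal.div_le_of_le_mul ?_
    rw [mul_comm, ← div_eq_mul_inv, ENNReal.le_div_iff_mul_le (Or.inl hN1)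
      (Or.inl (ENNReal.natCast_ne_top _))]
    exact_mod_cast card_dual_mul_le hN hj

-- Substituting k = N m gains N^(-αp) ≤ 1/N. It handles the frequencies that are dual for every z.
open Classical in
theorem tsum_multiples_freqWeight_le {α p : ℝ} {γ : ℕ → ℝ} (hα : 0 ≤ α) (hγ : ∀ j, 0 ≤ γ j)
    (hp : 0 ≤ p) (hαp : 1 ≤ α * p) {d N : ℕ} (hN : N ≠ 0) :
    (∑' k : Fin d → ℤ, if k ≠ 0 ∧ ∀ j, (N : ℤ) ∣ k j then freqWeight α γ k ^ p else 0) ≤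
      (N : ℝ≥0∞)⁻¹ * ∑' k : Fin d → ℤ, freqWeight α γ k ^ p := by
  have hNz : (N : ℤ) ≠ 0 := by exact_mod_cast hN
  have hinj : Function.Injective fun m : Fin d → ℤ => (N : ℤ) • m :=
    smul_right_injective _ hNz
  rw [← hinj.tsum_eq, ← ENNReal.tsum_mul_left]
  · refine ENNReal.tsum_le_tsum fun m => ?_
    split_ifs with h
    · have hm : m ≠ 0 := by
        rintro rfl
        simp at h
      refine (ENNReal.rpow_le_rpow (freqWeight_smul_le hα hγ hm hN) hp).trans ?_
      rw [ENNReal.mul_rpow_of_nonneg _ _ hp]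
      gcongr
      rw [ENNReal.ofReal_rpow_of_nonneg (by positivity) hp, Real.div_rpow zero_le_one
        (by positivity), Real.one_rpow, ← Real.rpow_mul (by positivity)]
      have hN1 : (1 : ℝ) ≤ N := by exact_mod_cast Nat.one_le_iff_ne_zero.2 hN
      rw [← ENNReal.ofReal_natCast, ← ENNReal.ofReal_inv_of_pos (by linarith), ← one_div]
      apply ENNReal.ofReal_le_ofReal
      apply one_div_le_one_div_of_le (by linarith)
      simpa using Real.rpow_le_rpow_of_exponent_le hN1 hαp
    · exact zero_le
  · intro k hk
    simp only [Function.mem_support, ne_eq, ite_eq_right_iff, not_forall] at hk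
    choose m hm using hk.1.2
    exact ⟨m, funext fun j => by simp [hm j]⟩

open Classical in
/-- The mean over the generating vectors of the dual lattice sums. -/
theorem sum_dual_tsum_le {α p : ℝ} {γ : ℕ → ℝ} (hα : 0 ≤ α) (hγ : ∀ j, 0 ≤ γ j)
    (hp : 0 ≤ p) (hαp : 1 ≤ α * p) {d N : ℕ} (hN : N.Prime) :
    ∑ z ∈ genVectors d N,
        (∑' k, if k ≠ 0 ∧ IsDualFreq N z k then freqWeight α γ k ^ p else 0) ≤
      (genVectors d N).card *
        (((N : ℝ≥0∞)⁻¹ + ((N - 1 : ℕ) : ℝ≥0∞)⁻¹) * ∑' k : Fin d → ℤ, freqWeight α γ k ^ p) := by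
  have h0' : ((genVectors d N).card : ℝ≥0∞) ≠ 0 := by
    exact_mod_cast card_genVectors_ne_zero d hN.two_le
  rw [← Summable.tsum_finsetSum fun _ _ => ENNReal.summable]
  refine le_trans ?_ (mul_le_mul_right (a := ((genVectors d N).card : ℝ≥0∞))
    (add_mul ((N : ℝ≥0∞)⁻¹) (((N - 1 : ℕ) : ℝ≥0∞)⁻¹) _).ge)
  refine le_trans ?_ (mul_le_mul_right (add_le_add_left
    (tsum_multiples_freqWeight_le hα hγ hp hαp (d := d) hN.ne_zero) _) _)
  rw [← ENNReal.tsum_mul_left, ← ENNReal.tsum_add, ← ENNReal.tsum_mul_left]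
  refine ENNReal.tsum_le_tsum fun k => ?_
  by_cases hk : k = 0
  · simp [hk]
  simp only [ne_eq, hk, not_false_eq_true, true_and]
  have h1 := dual_fraction_le hN k
  have h2 : (∑ z ∈ genVectors d N, if IsDualFreq N z k then freqWeight α γ k ^ p else 0) =
      (genVectors d N).card * (((genVectors d N).card : ℝ≥0∞)⁻¹ *
        ((genVectors d N).filter fun z => IsDualFreq N z k).card) * freqWeight α γ k ^ p := by
    rw [← mul_assoc, ENNReal.mul_inv_cancel h0' (ENNReal.natCast_ne_top _), one_mul,
      ← Finset.sum_filter, Finset.sum_const, nsmul_eq_mul]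
  rw [h2, mul_assoc]
  gcongr
  refine (mul_le_mul_left h1 _).trans_eq ?_
  rw [add_mul]
  congr 1
  split_ifs <;> simp

theorem two_mul_inv_le_of_mem_primeSet {M N : ℕ} (hM : 2 ≤ M) (hN : N ∈ primeSet M) :
    N.Prime ∧ ((N - 1 : ℕ) : ℝ≥0∞)⁻¹ ≤ ENNReal.ofReal (2 / M) ∧
      (N : ℝ≥0∞)⁻¹ ≤ ENNReal.ofReal (2 / M) := by
  simp only [primeSet, Finset.mem_filter, Finset.mem_Ioc] at hN
  have hM0 : (0 : ℝ) < M := by exact_mod_cast (by omega : 0 < M)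
  have h1 : (M : ℝ) / 2 ≤ ((N - 1 : ℕ) : ℝ) :=
    (Nat.le_ceil _).trans (by exact_mod_cast (by omega : ⌈(M : ℝ) / 2⌉₊ ≤ N - 1))
  have h2 : ((N - 1 : ℕ) : ℝ≥0∞)⁻¹ ≤ ENNReal.ofReal (2 / M) := by
    rw [← ENNReal.ofReal_natCast, ← ENNReal.ofReal_inv_of_pos (by linarith)]
    apply ENNReal.ofReal_le_ofReal
    rw [← one_div, show (2 : ℝ) / M = 1 / (M / 2) by field_simp]
    exact one_div_le_one_div_of_le (by linarith) h1
  refine ⟨hN.2, h2, le_trans ?_ h2⟩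
  rw [ENNReal.inv_le_inv]
  exact_mod_cast Nat.sub_le N 1

open Classical in
/-- At most a fraction `1 - η` of the generating vectors exceeds the stated worst-case error. -/
theorem card_bad_genVectors_le {α lam η W : ℝ} {γ : ℕ → ℝ} (hlam : 1 / 2 ≤ lam) (hα : lam ≤ α)
    (hγ : ∀ j, 0 ≤ γ j) (hη : η < 1) (hW : 0 < W) {d M N : ℕ} (hM : 2 ≤ M) (hN : N ∈ primeSet M)
    (hsum : ∑' k : Fin d → ℤ, freqWeight α γ k ^ (1 / lam) = ENNReal.ofReal W) :
    (((genVectors d N).filter fun z =>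
        ENNReal.ofReal (4 * W / ((1 - η) * M)) ^ lam <
          worstCaseError α γ (latticeRule N z)).card : ℝ≥0∞) ≤
      ENNReal.ofReal (1 - η) * (genVectors d N).card := by
  obtain ⟨hp, h1, h2⟩ := two_mul_inv_le_of_mem_primeSet hM hN
  have hl : 0 < lam := by linarith
  have hM0 : (0 : ℝ) < M := by exact_mod_cast (by omega : 0 < M)
  have hη' : 0 < 1 - η := by linarith
  -- The mean of the dual sums is at most (2/M + 2/M) W = 4W/M, so Markov's inequality at level a
  -- leaves the fraction 1 - η.
  set a := ENNReal.ofReal (4 * W / ((1 - η) * M)) with ha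
  have ha0 : a ≠ 0 := by
    rw [ha, ne_eq, ENNReal.ofReal_eq_zero, not_le]
    positivity
  rw [← ENNReal.mul_le_mul_iff_right ha0 ENNReal.ofReal_ne_top]
  set S := fun z : Fin d → ℕ =>
    ∑' k, if k ≠ 0 ∧ IsDualFreq N z k then freqWeight α γ k ^ (1 / lam) else 0
  have hbad : ∀ z ∈ (genVectors d N).filter fun z => a ^ lam <
      worstCaseError α γ (latticeRule N z), a ≤ S z := by
    intro z hz
    by_contra hlt
    push Not at hlt
    have h3 := (Finset.mem_filter.1 hz).2
    refine absurd h3 (not_lt.2 ?_)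
    exact (worstCaseError_latticeRule_le_rpow (by linarith) hp.ne_zero z hlam).trans
      (ENNReal.rpow_le_rpow hlt.le hl.le)
  calc a * (((genVectors d N).filter fun z => a ^ lam <
          worstCaseError α γ (latticeRule N z)).card : ℝ≥0∞)
      ≤ ∑ z ∈ (genVectors d N).filter fun z => a ^ lam <
          worstCaseError α γ (latticeRule N z), S z := by
        rw [mul_comm, ← nsmul_eq_mul]
        exact Finset.card_nsmul_le_sum _ _ _ hbad
    _ ≤ ∑ z ∈ genVectors d N, S z :=
        Finset.sum_le_sum_of_subset (Finset.filter_subset _ _)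
    _ ≤ (genVectors d N).card * (((N : ℝ≥0∞)⁻¹ + ((N - 1 : ℕ) : ℝ≥0∞)⁻¹) * ENNReal.ofReal W) := by
        rw [← hsum]
        refine sum_dual_tsum_le (by linarith) hγ (by positivity) ?_ hp
        rw [mul_one_div, one_le_div hl]
        exact hα
    _ ≤ (genVectors d N).card * ((ENNReal.ofReal (2 / M) + ENNReal.ofReal (2 / M)) *
          ENNReal.ofReal W) := by gcongr
    _ = a * (ENNReal.ofReal (1 - η) * (genVectors d N).card) := by
        rw [← mul_assoc a, mul_comm ((genVectors d N).card : ℝ≥0∞), ha,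
          ← ENNReal.ofReal_mul (by positivity),
          ← ENNReal.ofReal_add (by positivity) (by positivity),
          ← ENNReal.ofReal_mul (by positivity)]
        congr 2
        field_simp
        ring

/-! ### The probability that a frequency is aliased -/

open Classical in
/-- The probability that `k` lies in the dual lattice, for random `N` and one random `z`. -/
noncomputable def dualProb (M : ℕ) {d : ℕ} (k : Fin d → ℤ) : ℝ≥0∞ :=
  ∑ N ∈ primeSet M, ((primeSet M).card : ℝ≥0∞)⁻¹ * (((genVectors d N).card : ℝ≥0∞)⁻¹ *
    ((genVectors d N).filter fun z => IsDualFreq N z k).card)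

/-- At most log|k_j| / log(n+1) of the primes in (n, 2n] divide k_j, out of at least c n / log(2n);
for the other primes the fraction of dual z is at most 1/(N-1) ≤ 2/M. -/
theorem exists_dualProb_le :
    ∃ K : ℝ, 0 < K ∧ ∀ (M d : ℕ) (k : Fin d → ℤ) (j : Fin d), 2 ≤ M → k j ≠ 0 →
      dualProb M k ≤ ENNReal.ofReal ((2 + K * Real.log |(k j : ℝ)|) / M) := by
  classical
  obtain ⟨c, hc, hcard⟩ := exists_card_bertrandPrimes_lower_bound
  refine ⟨4 / c, by positivity, fun M d k j hM hj => ?_⟩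
  have hM0 : (0 : ℝ) < M := by exact_mod_cast (by omega : 0 < M)
  set n := ⌈(M : ℝ) / 2⌉₊ with hn
  have hnM : (M : ℝ) / 2 ≤ n := Nat.le_ceil _
  have hn0R : (0 : ℝ) < n := by linarith
  have hn0 : n ≠ 0 := by
    intro h
    rw [h] at hn0R
    simp at hn0R
  have hP : primeSet M = bertrandPrimes n := primeSet_eq_bertrandPrimes hM
  have hPpos := bertrandPrimes_card_pos hn0
  have hPposR : (0 : ℝ) < (bertrandPrimes n).card := by exact_mod_cast hPpos
  set D := (bertrandPrimes n).filter fun p : ℕ => (p : ℤ) ∣ k j with hD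
  have hDlog := card_bertrandPrimes_dvd_mul_log_le n hj
  rw [← hD] at hDlog
  have hfrac : (D.card : ℝ) / (bertrandPrimes n).card ≤ 4 / c * Real.log |(k j : ℝ)| / M := by
    have h1 := hcard n hn0
    have hn1 : (1 : ℝ) ≤ n := by exact_mod_cast Nat.one_le_iff_ne_zero.2 hn0
    -- Because 2n ≤ (n+1)², the two logarithms cancel up to a factor 2. With n ≥ M/2 this explains
    -- the constant 4/c.
    have h2 : Real.log (2 * n) ≤ 2 * Real.log (n + 1) := by
      rw [← Real.log_rpow (by positivity)]
      apply Real.log_le_log (by positivity)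
      norm_num
      nlinarith
    have h3 : 0 ≤ Real.log |(k j : ℝ)| := Real.log_nonneg (one_le_abs_intCast hj)
    rw [div_le_iff₀ hPposR]
    have h4 : (D.card : ℝ) * (c * n) ≤
        2 * Real.log |(k j : ℝ)| * (bertrandPrimes n).card := by
      calc (D.card : ℝ) * (c * n)
          ≤ D.card * ((bertrandPrimes n).card * (2 * Real.log (n + 1))) := by
            have := h1.trans (mul_le_mul_of_nonneg_left h2 hPposR.le)
            gcongr
        _ = 2 * (D.card * Real.log (n + 1)) * (bertrandPrimes n).card := by ring
        _ ≤ _ := by gcongr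
    have h5 : (D.card : ℝ) * (c * M) ≤
        4 * Real.log |(k j : ℝ)| * (bertrandPrimes n).card := by
      have : (D.card : ℝ) * (c * M) ≤ D.card * (c * (2 * n)) := by
        gcongr
        linarith
      linarith
    rw [show 4 / c * Real.log |(k j : ℝ)| / M * (bertrandPrimes n).card =
      4 * Real.log |(k j : ℝ)| * (bertrandPrimes n).card / (c * M) by field_simp,
      le_div_iff₀ (by positivity)]
    exact h5
  have hPE0 : ((bertrandPrimes n).card : ℝ≥0∞) ≠ 0 := by exact_mod_cast hPpos.ne'
  calc dualProb M k
      ≤ ∑ N ∈ primeSet M, ((primeSet M).card : ℝ≥0∞)⁻¹ *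
          ((if (N : ℤ) ∣ k j then 1 else 0) + ENNReal.ofReal (2 / M)) := by
        refine Finset.sum_le_sum fun N hN => ?_
        obtain ⟨hp, h1, -⟩ := two_mul_inv_le_of_mem_primeSet hM hN
        gcongr
        refine (dual_fraction_le hp k).trans (add_le_add ?_ h1)
        split_ifs with h2 h3
        · rfl
        · exact absurd (h2 j) h3
        · exact zero_le_one
        · rfl
    _ = ((bertrandPrimes n).card : ℝ≥0∞)⁻¹ * D.card + ENNReal.ofReal (2 / M) := by
        rw [hP, ← Finset.mul_sum, Finset.sum_add_distrib, mul_add, Finset.sum_const, nsmul_eq_mul,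
          ← mul_assoc, ENNReal.inv_mul_cancel hPE0 (ENNReal.natCast_ne_top _), one_mul,
          Finset.sum_boole]
    _ = ENNReal.ofReal ((D.card : ℝ) / (bertrandPrimes n).card + 2 / M) := by
        rw [ENNReal.ofReal_add (by positivity) (by positivity), ENNReal.ofReal_div_of_pos hPposR,
          ENNReal.ofReal_natCast, ENNReal.ofReal_natCast, mul_comm, ENNReal.div_eq_inv_mul, mul_comm]
    _ ≤ _ := by
        apply ENNReal.ofReal_le_ofReal
        rw [add_div]
        linarith

/-- Sacrificing w^ε ≤ |k_j|^(-αε) ≤ |k_j|^(-ε/2) absorbs the logarithm. Using only α ≥ 1/2 keeps the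
constant independent of α. -/
theorem exists_freqWeight_mul_dualProb_le {ε : ℝ} (hε : 0 < ε) (hε1 : ε ≤ 1) :
    ∃ K : ℝ, 0 < K ∧ ∀ (α : ℝ) (γ : ℕ → ℝ) (M d : ℕ) (k : Fin d → ℤ), 1 / 2 ≤ α →
      (∀ j, γ j ≤ 1) → 2 ≤ M → k ≠ 0 →
      freqWeight α γ k * dualProb M k ≤ ENNReal.ofReal (K / M) * freqWeight α γ k ^ (1 - ε) := by
  obtain ⟨K, hK, h⟩ := exists_dualProb_le
  refine ⟨2 + K * (1 / (ε / 2)), by positivity, fun α γ M d k hα hγ hM hk => ?_⟩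
  obtain ⟨j, hj⟩ := Function.ne_iff.1 hk
  simp only [Pi.zero_apply] at hj
  have h1 := h M d k j hM hj
  have hα0 : 0 ≤ α := by linarith
  have hM0 : (0 : ℝ) < M := by exact_mod_cast (by omega : 0 < M)
  have hx : (1 : ℝ) ≤ |(k j : ℝ)| := one_le_abs_intCast hj
  have h2 : freqWeight α γ k ^ ε ≤ ENNReal.ofReal (1 / |(k j : ℝ)| ^ (ε / 2)) := by
    refine (ENNReal.rpow_le_rpow (freqWeight_le_ofReal_coord hα0 hγ hj) hε.le).trans ?_
    rw [ENNReal.ofReal_rpow_of_nonneg (by positivity) hε.le]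
    apply ENNReal.ofReal_le_ofReal
    rw [Real.div_rpow zero_le_one (by positivity), Real.one_rpow,
      ← Real.rpow_mul (by positivity)]
    apply one_div_le_one_div_of_le (by positivity)
    exact Real.rpow_le_rpow_of_exponent_le hx (by nlinarith)
  have h3 : freqWeight α γ k = freqWeight α γ k ^ (1 - ε) * freqWeight α γ k ^ ε := by
    rw [← ENNReal.rpow_add_of_nonneg _ _ (by linarith) hε.le]
    simp
  conv_lhs => rw [h3, mul_assoc, mul_comm]
  gcongr
  refine (mul_le_mul' h2 h1).trans ?_
  rw [← ENNReal.ofReal_mul (by positivity)]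
  apply ENNReal.ofReal_le_ofReal
  have h4 := Real.log_le_rpow_div (abs_nonneg (k j : ℝ)) (show 0 < ε / 2 by positivity)
  have h5 : 1 ≤ |(k j : ℝ)| ^ (ε / 2) := Real.one_le_rpow hx (by positivity)
  rw [← mul_div_assoc, one_div_mul_eq_div]
  gcongr
  rw [div_le_iff₀ (by linarith)]
  calc 2 + K * Real.log |(k j : ℝ)| ≤ 2 * |(k j : ℝ)| ^ (ε / 2) +
        K * (|(k j : ℝ)| ^ (ε / 2) / (ε / 2)) := by
        gcongr
        linarith
    _ = _ := by ring

/-! ### Expectations under the law of the draws -/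

theorem lintegral_drawLaw (d r M : ℕ) (g : ℕ × (Fin r → Fin d → ℕ) → ℝ≥0∞) :
    ∫⁻ ω, g ω ∂(drawLaw d r M) =
      ∑ N ∈ primeSet M, ((primeSet M).card : ℝ≥0∞)⁻¹ *
        (((genTuples d r N).card : ℝ≥0∞)⁻¹ * ∑ Z ∈ genTuples d r N, g (N, Z)) := by
  simp only [drawLaw, lintegral_finsetSum_measure, lintegral_smul_measure, lintegral_dirac,
    smul_eq_mul, mul_assoc, Finset.mul_sum]

theorem card_filter_genTuples_forall {d r N : ℕ} (p : (Fin d → ℕ) → Prop) [DecidablePred p] :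
    ((genTuples d r N).filter fun Z => ∀ i, p (Z i)).card =
      ((genVectors d N).filter p).card ^ r := by
  have : ((genTuples d r N).filter fun Z => ∀ i, p (Z i)) =
      Fintype.piFinset fun _ : Fin r => (genVectors d N).filter p := by
    ext Z
    simp [genTuples, Fintype.mem_piFinset, forall_and]
  rw [this]
  simp

theorem card_filter_genTuples_apply {d r N : ℕ} (p : (Fin d → ℕ) → Prop) [DecidablePred p]
    (i : Fin r) :
    ((genTuples d r N).filter fun Z => p (Z i)).card =
      ((genVectors d N).filter p).card * (genVectors d N).card ^ (r - 1) := by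
  have : ((genTuples d r N).filter fun Z => p (Z i)) =
      Fintype.piFinset (Function.update (fun _ : Fin r => genVectors d N) i
        ((genVectors d N).filter p)) := by
    ext Z
    simp only [genTuples, Finset.mem_filter, Fintype.mem_piFinset]
    constructor
    · rintro ⟨h1, h2⟩ j
      by_cases hj : j = i
      · subst hj
        simpa using ⟨h1 j, h2⟩
      · simpa [hj] using h1 j
    · intro h
      have h1 := h i
      simp only [Function.update_self, Finset.mem_filter] at h1
      refine ⟨fun j => ?_, h1.2⟩
      by_cases hj : j = i
      · subst hj
        exact h1.1
      · simpa [hj] using h j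
  rw [this, Fintype.card_piFinset, ← Finset.mul_prod_erase _ _ (Finset.mem_univ i),
    Function.update_self, Finset.prod_congr rfl (g := fun _ => (genVectors d N).card),
    Finset.prod_const, Finset.card_erase_of_mem (Finset.mem_univ i), Finset.card_univ,
    Fintype.card_fin]
  intro j hj
  rw [Function.update_of_ne (Finset.ne_of_mem_erase hj)]

theorem inv_card_genTuples_mul_card_filter_apply {d r N : ℕ} (hN : 2 ≤ N)
    (p : (Fin d → ℕ) → Prop) [DecidablePred p] (i : Fin r) :
    ((genTuples d r N).card : ℝ≥0∞)⁻¹ * ((genTuples d r N).filter fun Z => p (Z i)).card =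
      ((genVectors d N).card : ℝ≥0∞)⁻¹ * ((genVectors d N).filter p).card := by
  have h0 : ((genVectors d N).card : ℝ≥0∞) ≠ 0 := by
    exact_mod_cast card_genVectors_ne_zero d hN
  have hr : r = (r - 1) + 1 := by
    have := i.pos
    omega
  have hpow : ((genVectors d N).card : ℝ≥0∞) ^ (r - 1) ≠ 0 := pow_ne_zero _ h0
  have hpow' : ((genVectors d N).card : ℝ≥0∞) ^ (r - 1) ≠ ∞ :=
    ENNReal.pow_ne_top (ENNReal.natCast_ne_top _)
  rw [card_filter_genTuples_apply, card_genTuples]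
  conv_lhs => rw [hr]
  simp only [Nat.add_sub_cancel]
  push_cast
  rw [pow_succ, ENNReal.mul_inv (Or.inl hpow) (Or.inl hpow')]
  calc _ = (((genVectors d N).card : ℝ≥0∞) ^ (r - 1))⁻¹ *
        ((genVectors d N).card : ℝ≥0∞) ^ (r - 1) * (((genVectors d N).card : ℝ≥0∞)⁻¹ *
          ((genVectors d N).filter p).card) := by ring
    _ = _ := by rw [ENNReal.inv_mul_cancel hpow hpow', one_mul]

open Classical in
/-- The error of the selected rule is controlled by the worst possible error if all draws are bad,
and by the aliased Fourier coefficients of small weight otherwise. -/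
theorem ofReal_abs_error_algRule_le {α : ℝ} {γ : ℕ → ℝ} (hα : 0 ≤ α) {d r M : ℕ}
    {sel : ℕ × (Fin r → Fin d → ℕ) → Fin r} (hsel : IsArgminSelection α γ d r M sel)
    {f : (Fin d → ℝ) → ℝ} (hf : f ∈ korobovBall α γ d) (T : ℝ≥0∞) {N : ℕ} (hN : N ∈ primeSet M)
    {Z : Fin r → Fin d → ℕ} (hZ : Z ∈ genTuples d r N) :
    ENNReal.ofReal |cubeIntegral f - algRule sel (N, Z) f| ≤
      (if ∀ i, T < worstCaseError α γ (latticeRule N (Z i)) then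
        (∑' k : Fin d → ℤ, freqWeight α γ k ^ (2 : ℝ)) ^ (1 / 2 : ℝ) else 0) +
      ∑ i, ∑' k, if IsDualFreq N (Z i) k then
        (if k ≠ 0 ∧ freqWeight α γ k ≤ T then ‖fourierCoef f k‖ₑ else 0) else 0 := by
  have hN0 : N ≠ 0 := (Finset.mem_filter.1 hN).2.ne_zero
  set s := sel (N, Z) with hs
  have hrule : algRule sel (N, Z) f = latticeRule N (Z s) f := rfl
  rw [hrule]
  by_cases hbad : ∀ i, T < worstCaseError α γ (latticeRule N (Z i))
  · rw [if_pos hbad]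
    refine le_trans ?_ le_self_add
    refine (le_iSup₂ (f := fun f _ => ENNReal.ofReal |cubeIntegral f - latticeRule N (Z s) f|)
      f hf).trans ((worstCaseError_latticeRule_le hα hN0 (Z s)).trans ?_)
    refine ENNReal.rpow_le_rpow (ENNReal.tsum_le_tsum fun k => ?_) (by norm_num)
    split_ifs
    · simp
    · exact zero_le
  · rw [if_neg hbad, zero_add]
    push Not at hbad
    obtain ⟨i, hi⟩ := hbad
    have hTs : worstCaseError α γ (latticeRule N (Z s)) ≤ T := (hsel N hN Z hZ i).trans hi
    refine (ofReal_abs_error_le hf.1 hN0 (Z s)).trans ?_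
    -- The selected index depends on all draws, so its sum is enlarged to the sum over all i, whose
    -- terms each involve a single uniform vector. The cosine bound makes the restriction w(k) ≤ T
    -- free.
    refine le_trans (ENNReal.tsum_le_tsum fun k => ?_) (Finset.single_le_sum
      (f := fun i => ∑' k, if IsDualFreq N (Z i) k then
        (if k ≠ 0 ∧ freqWeight α γ k ≤ T then ‖fourierCoef f k‖ₑ else 0) else 0)
      (fun _ _ => zero_le) (Finset.mem_univ s))
    split_ifs with h1 h2 h3 h4
    · rfl
    · exact absurd ⟨h1.1, (freqWeight_le_worstCaseError hα hN0 (Z s) h1.1 h1.2).trans hTs⟩ h3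
    · exact absurd h1.2 h2
    all_goals exact zero_le

theorem inv_card_mul_sum_le {ι : Type*} (s : Finset ι) {g : ι → ℝ≥0∞} {b : ℝ≥0∞}
    (h : ∀ i ∈ s, g i ≤ b) : ∑ i ∈ s, (s.card : ℝ≥0∞)⁻¹ * g i ≤ b := by
  calc ∑ i ∈ s, (s.card : ℝ≥0∞)⁻¹ * g i ≤ ∑ i ∈ s, (s.card : ℝ≥0∞)⁻¹ * b :=
        Finset.sum_le_sum fun i hi => by gcongr; exact h i hi
    _ = ((s.card : ℝ≥0∞)⁻¹ * s.card) * b := by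
        rw [Finset.sum_const, nsmul_eq_mul]; ring
    -- An inequality suffices and also covers the empty set, where ∞ * 0 = 0.
    _ ≤ b := mul_le_of_le_one_left' (ENNReal.inv_mul_le_one _)

-- Independence turns the event that all draws are bad into q^r. In the other term each z_i is
-- uniform, so averaging over N gives `dualProb` for each of the r indices.
open Classical in
theorem lintegral_error_le {α : ℝ} {γ : ℕ → ℝ} (hα : 0 ≤ α) {d r M : ℕ}
    {sel : ℕ × (Fin r → Fin d → ℕ) → Fin r} (hsel : IsArgminSelection α γ d r M sel)
    {f : (Fin d → ℝ) → ℝ} (hf : f ∈ korobovBall α γ d) (T q : ℝ≥0∞)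
    (hbad : ∀ N ∈ primeSet M, (((genVectors d N).filter fun z =>
        T < worstCaseError α γ (latticeRule N z)).card : ℝ≥0∞) ≤ q * (genVectors d N).card) :
    ∫⁻ ω, ENNReal.ofReal |cubeIntegral f - algRule sel ω f| ∂(drawLaw d r M) ≤
      r * (∑' k : Fin d → ℤ, if k ≠ 0 ∧ freqWeight α γ k ≤ T then
        ‖fourierCoef f k‖ₑ * dualProb M k else 0) +
      q ^ r * (∑' k : Fin d → ℤ, freqWeight α γ k ^ (2 : ℝ)) ^ (1 / 2 : ℝ) := by
  set B := (∑' k : Fin d → ℤ, freqWeight α γ k ^ (2 : ℝ)) ^ (1 / 2 : ℝ)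
  set c : (Fin d → ℤ) → ℝ≥0∞ := fun k =>
    if k ≠ 0 ∧ freqWeight α γ k ≤ T then ‖fourierCoef f k‖ₑ else 0 with hc
  set P : ℝ≥0∞ := ((primeSet M).card : ℝ≥0∞)⁻¹
  have hN2 : ∀ N ∈ primeSet M, 2 ≤ N := fun N hN => (Finset.mem_filter.1 hN).2.two_le
  rw [lintegral_drawLaw]
  have hstep : ∀ N ∈ primeSet M, ((genTuples d r N).card : ℝ≥0∞)⁻¹ * ∑ Z ∈ genTuples d r N,
      ENNReal.ofReal |cubeIntegral f - algRule sel (N, Z) f| ≤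
      q ^ r * B + r * ∑' k, (((genVectors d N).card : ℝ≥0∞)⁻¹ *
        ((genVectors d N).filter fun z => IsDualFreq N z k).card) * c k := by
    intro N hN
    have h0 : ((genTuples d r N).card : ℝ≥0∞) ≠ 0 := by
      rw [card_genTuples]
      exact_mod_cast pow_ne_zero r (card_genVectors_ne_zero d (hN2 N hN))
    calc _ ≤ ((genTuples d r N).card : ℝ≥0∞)⁻¹ * ∑ Z ∈ genTuples d r N,
          ((if ∀ i, T < worstCaseError α γ (latticeRule N (Z i)) then B else 0) +
            ∑ i, ∑' k, if IsDualFreq N (Z i) k then c k else 0) := by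
          gcongr with Z hZ
          exact ofReal_abs_error_algRule_le hα hsel hf T hN hZ
      _ = ((genTuples d r N).card : ℝ≥0∞)⁻¹ * (((genTuples d r N).filter fun Z => ∀ i, T <
            worstCaseError α γ (latticeRule N (Z i))).card * B) +
          ∑ i : Fin r, ∑' k, (((genTuples d r N).card : ℝ≥0∞)⁻¹ *
            ((genTuples d r N).filter fun Z => IsDualFreq N (Z i) k).card) * c k := by
          rw [Finset.sum_add_distrib, mul_add, ← Finset.sum_filter, Finset.sum_const, nsmul_eq_mul,
            Finset.sum_comm, Finset.mul_sum]
          congr 1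
          refine Finset.sum_congr rfl fun i _ => ?_
          rw [← Summable.tsum_finsetSum fun _ _ => ENNReal.summable, ← ENNReal.tsum_mul_left]
          refine tsum_congr fun k => ?_
          rw [← Finset.sum_filter, Finset.sum_const, nsmul_eq_mul, mul_assoc]
      _ ≤ q ^ r * B + r * ∑' k, (((genVectors d N).card : ℝ≥0∞)⁻¹ *
            ((genVectors d N).filter fun z => IsDualFreq N z k).card) * c k := by
          refine add_le_add ?_ (le_of_eq ?_)
          · rw [← mul_assoc]
            gcongr
            rw [mul_comm, ← div_eq_mul_inv]
            refine ENNReal.div_le_of_le_mul ?_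
            rw [card_filter_genTuples_forall fun z => T < worstCaseError α γ (latticeRule N z),
              card_genTuples]
            push_cast
            rw [← mul_pow]
            gcongr
            exact hbad N hN
          · refine (Finset.sum_congr rfl fun i _ => tsum_congr fun k => congrArg (· * c k)
              (inv_card_genTuples_mul_card_filter_apply (hN2 N hN)
                (fun z => IsDualFreq N z k) i)).trans ?_
            simp
  calc _ ≤ ∑ N ∈ primeSet M, P * (q ^ r * B + r * ∑' k, (((genVectors d N).card : ℝ≥0∞)⁻¹ *
        ((genVectors d N).filter fun z => IsDualFreq N z k).card) * c k) := by
        gcongr with N hN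
        exact hstep N hN
    _ = ∑ N ∈ primeSet M, P * (q ^ r * B) + r * ∑' k, dualProb M k * c k := by
        simp only [mul_add, Finset.sum_add_distrib]
        congr 1
        simp only [dualProb, Finset.sum_mul]
        rw [Summable.tsum_finsetSum fun _ _ => ENNReal.summable, Finset.mul_sum]
        refine Finset.sum_congr rfl fun N _ => ?_
        rw [mul_left_comm, ← ENNReal.tsum_mul_left]
        simp only [P, mul_assoc]
    _ ≤ q ^ r * B + r * ∑' k, dualProb M k * c k := by
        gcongr
        exact inv_card_mul_sum_le _ fun _ _ => le_rfl
    _ = _ := by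
        rw [add_comm]
        congr 3
        ext k
        simp only [hc]
        split_ifs
        · rw [mul_comm]
        · simp

-- Split w^(1-ε) = w^e w^(1/(2λ)) with e ≥ 0. The first factor is at most T^e, and the squares of
-- the second sum to W, so Cauchy-Schwarz leaves W^(1/2).
open Classical in
theorem tsum_aliased_le {α lam ε K W : ℝ} {γ : ℕ → ℝ} (hα : 0 ≤ α)
    (hlam : 0 < lam) (hε : ε ≤ 1 - 1 / (2 * lam)) {d M : ℕ}
    (hprob : ∀ k : Fin d → ℤ, k ≠ 0 →
      freqWeight α γ k * dualProb M k ≤ ENNReal.ofReal (K / M) * freqWeight α γ k ^ (1 - ε))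
    (hsum : ∑' k : Fin d → ℤ, freqWeight α γ k ^ (1 / lam) = ENNReal.ofReal W)
    {f : (Fin d → ℝ) → ℝ} (hf : f ∈ korobovBall α γ d) (T : ℝ≥0∞) :
    (∑' k : Fin d → ℤ, if k ≠ 0 ∧ freqWeight α γ k ≤ T then
        ‖fourierCoef f k‖ₑ * dualProb M k else 0) ≤
      ENNReal.ofReal (K / M) * T ^ (1 - ε - 1 / (2 * lam)) * ENNReal.ofReal W ^ (1 / 2 : ℝ) := by
  have hl2 : 0 < 1 / (2 * lam) := by positivity
  have h1 := tsum_fourierCoef_mul_le hα hf fun k =>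
    if k ≠ 0 ∧ freqWeight α γ k ≤ T then dualProb M k else 0
  simp only [mul_ite, mul_zero] at h1
  refine h1.trans ?_
  set e := 1 - ε - 1 / (2 * lam) with he
  have he0 : 0 ≤ e := by linarith
  have h2 : ∀ k : Fin d → ℤ,
      (if k ≠ 0 ∧ freqWeight α γ k ≤ T then freqWeight α γ k * dualProb M k else 0) ^ 2 ≤
        (ENNReal.ofReal (K / M) * T ^ e) ^ 2 * freqWeight α γ k ^ (1 / lam) := by
    intro k
    split_ifs with h
    · have h3 : freqWeight α γ k * dualProb M k ≤
          (ENNReal.ofReal (K / M) * T ^ e) * freqWeight α γ k ^ (1 / (2 * lam)) := by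
        refine (hprob k h.1).trans ?_
        rw [mul_assoc, show 1 - ε = e + 1 / (2 * lam) by rw [he]; ring,
          ENNReal.rpow_add_of_nonneg _ _ he0 hl2.le]
        gcongr
        exact h.2
      calc _ ≤ ((ENNReal.ofReal (K / M) * T ^ e) * freqWeight α γ k ^ (1 / (2 * lam))) ^ 2 := by
            gcongr
        _ = _ := by
            rw [mul_pow, ← ENNReal.rpow_natCast (freqWeight α γ k ^ (1 / (2 * lam))),
              ← ENNReal.rpow_mul]
            congr 2
            push_cast
            field_simp
    · simp
  refine (ENNReal.rpow_le_rpow (ENNReal.tsum_le_tsum h2) (by norm_num)).trans_eq ?_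
  rw [ENNReal.tsum_mul_left, hsum, ENNReal.mul_rpow_of_nonneg _ _ (by norm_num),
    ← ENNReal.rpow_natCast, ← ENNReal.rpow_mul]
  norm_num

/-! ### Choice of parameters and the final bound -/

theorem one_le_weightProd {α lam : ℝ} {γ : ℕ → ℝ} (hlam : 0 < lam) (hα : lam < α)
    (hγ : ∀ j, 0 ≤ γ j) (d : ℕ) : 1 ≤ weightProd α γ d lam := by
  calc (1 : ℝ) = ∏ _j : Fin d, 1 := by simp
    _ ≤ _ := Finset.prod_le_prod (fun _ _ => zero_le_one) fun j _ => ?_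
  have h1 := zetaR_nonneg ((one_lt_div hlam).2 hα)
  have h2 := hγ j
  have : 0 ≤ 2 * γ j ^ (1 / lam) * zetaR (α / lam) := by positivity
  linarith

theorem theorem3p3 (lam δ : ℝ) (hlam : 1 / 2 < lam) (hδ : 0 < δ) (hδ' : δ < min (lam - 1 / 2) 1) :
    ∃ C : ℝ, 0 < C ∧
      ∀ (α : ℝ) (γ : ℕ → ℝ) (d r M : ℕ) (η : ℝ)
        (sel : ℕ × (Fin r → Fin d → ℕ) → Fin r),
        1 / 2 < α → lam < α → (∀ j, 0 ≤ γ j ∧ γ j ≤ 1) → 1 ≤ r → 2 ≤ M → 0 < η → η < 1 →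
        sInf ((fun l : ℝ => 2 * weightProd α γ d l) '' Set.Ico (1 / 2) α) ≤ (1 - η) * M →
        IsArgminSelection α γ d r M sel →
        randomizedError α γ (drawLaw d r M) (algRule sel) ≤
          ENNReal.ofReal
            (r * C / ((1 - η) ^ (lam - δ - 1 / 2) * (M : ℝ) ^ (lam - δ + 1 / 2)) *
                weightProd α γ d lam ^ (lam - δ) +
              (1 - η) ^ r * ∏ j : Fin d, (1 + 2 * γ j ^ 2 * zetaR (2 * α)) ^ (1 / 2 : ℝ)) := by
  have hl : 0 < lam := by linarith
  have hδl : δ < lam - 1 / 2 := hδ'.trans_le (min_le_left _ _)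
  -- The choice ε = δ/λ turns the exponent of T = (4W/((1-η)M))^λ into λ(1 - ε - 1/(2λ)) = λ - δ -
  -- 1/2.
  obtain ⟨K, hK, hprob⟩ := exists_freqWeight_mul_dualProb_le (ε := δ / lam) (by positivity)
    (by rw [div_le_one hl]; linarith)
  refine ⟨K * 4 ^ (lam - δ - 1 / 2), by positivity, ?_⟩
  intro α γ d r M η sel hα hlα hγ _ hM _ hη _ hsel
  have hγ0 : ∀ j, 0 ≤ γ j := fun j => (hγ j).1
  have hα0 : 0 ≤ α := by linarith
  have hM0 : (0 : ℝ) < M := by exact_mod_cast (by omega : 0 < M)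
  have hη' : 0 < 1 - η := by linarith
  set W := weightProd α γ d lam with hW
  have hW0 : 0 < W := zero_lt_one.trans_le (one_le_weightProd hl hlα hγ0 d)
  have hsum : ∑' k : Fin d → ℤ, freqWeight α γ k ^ (1 / lam) = ENNReal.ofReal W := by
    rw [tsum_freqWeight_rpow hγ0 (by positivity) (by rwa [mul_one_div, one_lt_div hl])]
    simp only [mul_one_div, hW, weightProd]
  have hsum2 : (∑' k : Fin d → ℤ, freqWeight α γ k ^ (2 : ℝ)) ^ (1 / 2 : ℝ) =
      ENNReal.ofReal (∏ j : Fin d, (1 + 2 * γ j ^ 2 * zetaR (2 * α)) ^ (1 / 2 : ℝ)) := by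
    have hz := zetaR_nonneg (show 1 < 2 * α by linarith)
    rw [tsum_freqWeight_rpow hγ0 (by norm_num) (by linarith),
      ENNReal.ofReal_rpow_of_nonneg _ (by norm_num), Real.finsetProd_rpow]
    · simp only [Real.rpow_two, mul_comm α 2]
    · intro j _
      positivity
    · refine Finset.prod_nonneg fun j _ => ?_
      rw [mul_comm α 2, Real.rpow_two]
      positivity
  refine iSup₂_le fun f hf => ?_
  refine (lintegral_error_le hα0 hsel hf (ENNReal.ofReal (4 * W / ((1 - η) * M)) ^ lam)
    (ENNReal.ofReal (1 - η))
    (fun N hN => card_bad_genVectors_le hlam.le hlα.le hγ0 hη hW0 hM hN hsum)).trans ?_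
  have hexp : δ / lam ≤ 1 - 1 / (2 * lam) := by
    rw [div_le_iff₀ hl]
    have : (1 - 1 / (2 * lam)) * lam = lam - 1 / 2 := by field_simp
    linarith
  refine (add_le_add_left (mul_le_mul_right (tsum_aliased_le hα0 hl hexp
    (fun k hk => hprob α γ M d k hα.le (fun j => (hγ j).2) hM hk) hsum hf _) _) _).trans_eq ?_
  have hprodnn : 0 ≤ ∏ j : Fin d, (1 + 2 * γ j ^ 2 * zetaR (2 * α)) ^ (1 / 2 : ℝ) := by
    have hz := zetaR_nonneg (show 1 < 2 * α by linarith)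
    positivity
  rw [hsum2, ENNReal.ofReal_add (by positivity) (by positivity),
    ENNReal.ofReal_mul (p := (1 - η) ^ r) (by positivity), ENNReal.ofReal_pow hη'.le]
  congr 1
  rw [← ENNReal.rpow_mul, ENNReal.ofReal_rpow_of_pos (by positivity),
    ENNReal.ofReal_rpow_of_pos hW0, ← ENNReal.ofReal_mul (by positivity),
    ← ENNReal.ofReal_mul (by positivity), ← ENNReal.ofReal_natCast,
    ← ENNReal.ofReal_mul (by positivity)]
  congr 1
  have he : lam * (1 - δ / lam - 1 / (2 * lam)) = lam - δ - 1 / 2 := by field_simp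
  rw [he, Real.div_rpow (by positivity) (by positivity), Real.mul_rpow (by positivity) hW0.le,
    Real.mul_rpow hη'.le hM0.le, show lam - δ + 1 / 2 = (lam - δ - 1 / 2) + 1 by ring,
    Real.rpow_add_one hM0.ne']
  -- The power of W has two sources: λ - δ - 1/2 from the threshold and 1/2 from Cauchy-Schwarz.
  have hWs : W ^ (lam - δ) = W ^ (lam - δ - 1 / 2) * W ^ (1 / 2 : ℝ) := by
    rw [← Real.rpow_add hW0]
    congr 1
    ring
  rw [hWs]
  field_simp
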